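/- Let $\mathbb{K}$ be an algebraically closed field of characteristic $p>0$ and let $G$ be a connected affine algebraic group over $\mathbb{K}$ with Lie algebra $\mathfrak{g}$, viewed as the algebra of left invariant derivations of $\mathbb{K}[G]$, so that $x\mapsto x^{[p]}$ is the $p$-th power of derivations. Suppose given: a non-degenerate $G$-invariant bilinear form $(\cdot,\cdot)$ on $\mathfrak{g}$; a nilpotent element $e\in\mathfrak{g}$ (that is, $e^{[p]^i}=0$ for $i\gg 0$), with $\chi:=(e,\cdot)\in\mathfrak{g}^*$; and a Dynkin torus for $e$, i.e. a cocharacter $\lambda_e:\mathbb{K}^\times\to G$ such that, with $\mathfrak{g}(i)=\{x\in\mathfrak{g}:\operatorname{Ad}(\lambda_e(t))x=t^ix\ \text{for all } t\}$, one has $e\in\mathfrak{g}(2)$ and $\mathfrak{g}_e\subseteq\bigoplus_{i\ge 0}\mathfrak{g}(i)$, where $\mathfrak{g}_e$ is the centraliser of $e$. (If $G$ is reductive and simply connected, $p$ is good for $G$ and such a form exists, then every nilpotent $e$ has a Dynkin torus.) Let $\mathfrak{l}\subseteq\mathfrak{g}(-1)$ be a maximal totally isotropic subspace for $\Phi(x,y)=(e,[x,y])$,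 such that moreover $(e,u^{[2]})=0$ for all $u\in\mathfrak{l}$ if $p=2$. Put $$\mathfrak{m}:=\mathfrak{l}\oplus\sum_{i<-1}\mathfrak{g}(i),\qquad \mathfrak{m}^\perp:=\{\psi\in\mathfrak{g}^*:\psi(\mathfrak{m})=0\},\qquad Q_\chi:=U(\mathfrak{g})\otimes_{U(\mathfrak{m})}\mathbb{K}_\chi ,$$ where $\mathbb{K}_\chi$ is the one-dimensional $\mathfrak{m}$-module given by the character $\chi|_{\mathfrak{m}}$. Let $Z_0(\mathfrak{g})\subseteq U(\mathfrak{g})$ be the $p$-centre, the (central) subalgebra generated by all $\xi(x)=x^p-x^{[p]}$, $x\in\mathfrak{g}$. For $\eta\in\mathfrak{g}^*$ let $I_\eta$ be the ideal of $Z_0(\mathfrak{g})$ generated by all $\xi(x)-\eta(x)^p$, $x\in\mathfrak{g}$; this identifies $\mathfrak{g}^*$ with the maximal spectrum of $Z_0(\mathfrak{g})$, and an element of $Z_0(\mathfrak{g})$ vanishes at $\eta$ if it lies in $I_\eta$. Let $I(\mathfrak{m})$ be the ideal of all elements of $Z_0(\mathfrak{g})$ vanishing at every point of $\chi+\mathfrak{m}^\perp$.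 Then: 1. $I(\mathfrak{m})=\operatorname{Ann}_{Z_0(\mathfrak{g})}Q_\chi$; 2. $Q_\chi$ is a free $Z_0(\mathfrak{g})/I(\mathfrak{m})$-module of rank $p^{\dim(\mathfrak{m}^\perp)}$. -/

import Mathlib

open scoped TensorProduct LaurentPolynomial

namespace ModularW

section PPower

variable {K A : Type*} [Field K] (p : ℕ) [Fact p.Prime] [CharP K p]

theorem commute_add_pow {S : Type*} [Ring S] [Algebra K S] {a b : S} (h : Commute a b) :
    (a + b) ^ p = a ^ p + b ^ p := by
  have hp : ((p : ℕ) : S) = 0 := by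
    rw [← map_natCast (algebraMap K S) p, CharP.cast_eq_zero, map_zero]
  rw [h.add_pow_prime_eq (Fact.out : p.Prime), hp]
  simp

theorem commutator_iterate {S : Type*} [Ring S] [Algebra K S] (x y : S) :
    (fun z => x * z - z * x)^[p] y = x ^ p * y - y * x ^ p := by
  have hc : Commute (LinearMap.mulLeft K x - LinearMap.mulRight K x) (LinearMap.mulRight K x) :=
    (LinearMap.commute_mulLeft_right (R := K) x x).sub_left (Commute.refl _)
  have h := commute_add_pow (K := K) p hc
  rw [sub_add_cancel, LinearMap.pow_mulLeft, LinearMap.pow_mulRight] at h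
  have h2 := LinearMap.congr_fun h y
  have h3 : (fun z => x * z - z * x) = ⇑(LinearMap.mulLeft K x - LinearMap.mulRight K x) := by
    ext z; simp
  rw [h3, ← Module.End.pow_apply, eq_sub_iff_add_eq]
  simpa using h2.symm

variable [CommRing A] [Algebra K A]

/-- In characteristic `p`, the `p`-th power of a derivation is a derivation. -/
def derivationPow (D : Derivation K A A) : Derivation K A A :=
  Derivation.mk' ((D : A →ₗ[K] A) ^ p : Module.End K A) (by
    intro a b
    let E : Module.End K A := (D : A →ₗ[K] A)
    have h1 : E ∘ₗ LinearMap.mul' K A = LinearMap.mul' K A ∘ₗ (E.rTensor A + E.lTensor A) := by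
      apply TensorProduct.ext'
      intro x y
      simp [E, mul_comm, add_comm]
    have h2 : ∀ n : ℕ, (E ^ n) ∘ₗ LinearMap.mul' K A =
        LinearMap.mul' K A ∘ₗ ((E.rTensor A + E.lTensor A : Module.End K (A ⊗[K] A)) ^ n) := by
      intro n
      induction n with
      | zero => rfl
      | succ n ih =>
        rw [pow_succ', pow_succ, Module.End.mul_eq_comp, LinearMap.comp_assoc, ih,
          ← LinearMap.comp_assoc, h1, LinearMap.comp_assoc, ← Module.End.mul_eq_comp, ← pow_succ',
          ← pow_succ]
    have hc : Commute (E.rTensor A : Module.End K (A ⊗[K] A)) (E.lTensor A) := by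
      change _ ∘ₗ _ = _ ∘ₗ _
      rw [LinearMap.rTensor_comp_lTensor, LinearMap.lTensor_comp_rTensor]
    have h3 := LinearMap.congr_fun (h2 p) (a ⊗ₜ b)
    rw [commute_add_pow (K := K) p hc, LinearMap.rTensor_pow, LinearMap.lTensor_pow] at h3
    simpa [mul_comm, add_comm] using h3)

end PPower

section AlgebraicGroup

variable (K : Type*) [Field K] (A : Type*) [CommRing A] [HopfAlgebra K A]

/-- The group `G(K)` of `K`-points of the affine group with coordinate ring `A = K[G]`. -/
abbrev Points : Type _ := WithConv (A →ₐ[K] K)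

/-- The Lie algebra of `G`: derivations `D` of `K[G]` commuting with all left translations, that
is, `Δ ∘ D = (id ⊗ D) ∘ Δ`. The bracket is the commutator. -/
def lieAlg : LieSubalgebra K (Derivation K A A) where
  carrier := {D | Coalgebra.comul ∘ₗ (D : A →ₗ[K] A) =
    (D : A →ₗ[K] A).lTensor A ∘ₗ Coalgebra.comul}
  add_mem' := by
    intro a b ha hb
    simp only [Set.mem_ofPred_eq, Derivation.coe_add_linearMap] at *
    rw [LinearMap.comp_add, ha, hb, LinearMap.lTensor_add, LinearMap.add_comp]
  zero_mem' := by
    simp only [Set.mem_ofPred_eq, Derivation.coe_zero_linearMap]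
    rw [LinearMap.comp_zero, LinearMap.lTensor_zero, LinearMap.zero_comp]
  smul_mem' := by
    intro c a ha
    simp only [Set.mem_ofPred_eq, Derivation.coe_smul_linearMap] at *
    rw [LinearMap.comp_smul, ha, LinearMap.lTensor_smul, LinearMap.smul_comp]
  lie_mem' := by
    intro a b ha hb
    simp only [Set.mem_ofPred_eq] at *
    have h : ((⁅a, b⁆ : Derivation K A A) : A →ₗ[K] A) =
        (a : A →ₗ[K] A) ∘ₗ (b : A →ₗ[K] A) - (b : A →ₗ[K] A) ∘ₗ (a : A →ₗ[K] A) := by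
      ext x; rfl
    rw [h, LinearMap.comp_sub, ← LinearMap.comp_assoc, ha, LinearMap.comp_assoc, hb,
      ← LinearMap.comp_assoc, ← LinearMap.lTensor_comp, ← LinearMap.comp_assoc, hb,
      LinearMap.comp_assoc, ha, ← LinearMap.comp_assoc, ← LinearMap.lTensor_comp,
      LinearMap.lTensor_sub, LinearMap.sub_comp]

variable {K A}

theorem comul_lieAlg (x : lieAlg K A) (f : A) : Coalgebra.comul (R := K) (x.1 f) =
    (x.1 : A →ₗ[K] A).lTensor A (Coalgebra.comul f) :=
  LinearMap.congr_fun x.2 f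

theorem lieAlg_lie_apply (x y : lieAlg K A) (f : A) :
    (⁅x, y⁆ : lieAlg K A).1 f = x.1 (y.1 f) - y.1 (x.1 f) := by
  simp [Derivation.commutator_apply]

/-- The restricted structure `x ↦ x^[p]` of `Lie G`: the `p`-th power of a left invariant
derivation. -/
def pMap (p : ℕ) [Fact p.Prime] [CharP K p] (x : lieAlg K A) : lieAlg K A :=
  ⟨derivationPow p x.1, by
    have h : ∀ n : ℕ, Coalgebra.comul ∘ₗ ((x.1 : A →ₗ[K] A) ^ n : Module.End K A) =
        LinearMap.lTensor A ((x.1 : A →ₗ[K] A) ^ n : Module.End K A) ∘ₗ Coalgebra.comul := by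
      intro n
      have hx : Coalgebra.comul ∘ₗ (x.1 : A →ₗ[K] A) =
        (x.1 : A →ₗ[K] A).lTensor A ∘ₗ Coalgebra.comul := x.2
      induction n with
      | zero => simp [Module.End.one_eq_id]
      | succ n ih =>
        rw [pow_succ, Module.End.mul_eq_comp, ← LinearMap.comp_assoc, ih, LinearMap.comp_assoc,
          hx, ← LinearMap.comp_assoc, ← LinearMap.lTensor_comp]
    exact h p⟩

/-- Right translation of functions by a point: `(ρ_g f)(x) = f(xg)`. -/
def rightTranslation (g : Points K A) : A →ₐ[K] A :=
  ((Algebra.TensorProduct.rid K K A).toAlgHom.comp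
    (Algebra.TensorProduct.map (AlgHom.id K A) g.ofConv)).comp (Bialgebra.comulAlgHom K A)

theorem rightTranslation_apply (g : Points K A) (f : A) :
    rightTranslation g f = TensorProduct.rid K A
      (LinearMap.lTensor A (g.ofConv : A →ₗ[K] K) (Coalgebra.comul f)) := rfl

theorem comul_rightTranslation (g : Points K A) (f : A) :
    Coalgebra.comul (R := K) (rightTranslation g f) =
      (rightTranslation g : A →ₗ[K] A).lTensor A (Coalgebra.comul f) := by
  have h1 : ∀ t : A ⊗[K] A, Coalgebra.comul (R := K) (TensorProduct.rid K A
      (LinearMap.lTensor A (g.ofConv : A →ₗ[K] K) t)) =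
      TensorProduct.rid K (A ⊗[K] A) (LinearMap.lTensor (A ⊗[K] A) (g.ofConv : A →ₗ[K] K)
        (LinearMap.rTensor A Coalgebra.comul t)) := by
    intro t
    induction t with
    | zero => simp
    | tmul a b => simp
    | add a b ha hb => simp only [map_add, ha, hb]
  have h2 : ∀ t : A ⊗[K] (A ⊗[K] A), TensorProduct.rid K (A ⊗[K] A)
      (LinearMap.lTensor (A ⊗[K] A) (g.ofConv : A →ₗ[K] K)
        ((TensorProduct.assoc K A A A).symm t)) =
      LinearMap.lTensor A ((TensorProduct.rid K A).toLinearMap ∘ₗ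
        LinearMap.lTensor A (g.ofConv : A →ₗ[K] K)) t := by
    intro t
    induction t with
    | zero => simp
    | tmul a b =>
      induction b with
      | zero => simp
      | tmul b c => simp
      | add a b ha hb => simp only [map_add, TensorProduct.tmul_add, ha, hb]
    | add a b ha hb => simp only [map_add, ha, hb]
  have h3 : (rightTranslation g : A →ₗ[K] A) = ((TensorProduct.rid K A).toLinearMap ∘ₗ
        LinearMap.lTensor A (g.ofConv : A →ₗ[K] K)) ∘ₗ Coalgebra.comul := rfl
  rw [rightTranslation_apply, h1, ← Coalgebra.coassoc_symm_apply, h2, h3,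
    LinearMap.lTensor_comp _ _ Coalgebra.comul]
  rfl

theorem point_rightTranslation (g h : Points K A) (f : A) :
    g.ofConv (rightTranslation h f) = (g * h).ofConv f := by
  have : ∀ t : A ⊗[K] A, g.ofConv (TensorProduct.rid K A
      (LinearMap.lTensor A (h.ofConv : A →ₗ[K] K) t)) =
      Algebra.TensorProduct.lmul' K (Algebra.TensorProduct.map g.ofConv h.ofConv t) := by
    intro t
    induction t with
    | zero => simp
    | tmul a b => simp [mul_comm]
    | add a b ha hb => simp only [map_add, ha, hb]
  rw [rightTranslation_apply, this]
  rfl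

theorem rightTranslation_one : rightTranslation (1 : Points K A) = AlgHom.id K A := by
  ext f
  rw [rightTranslation_apply]
  have : ((1 : Points K A).ofConv : A →ₗ[K] K) = Coalgebra.counit := by ext; rfl
  rw [this, Coalgebra.lTensor_counit_comul]
  simp

theorem rightTranslation_mul (g h : Points K A) :
    rightTranslation (g * h) = (rightTranslation g).comp (rightTranslation h) := by
  ext f
  rw [AlgHom.comp_apply, rightTranslation_apply g, comul_rightTranslation,
    ← LinearMap.comp_apply, ← LinearMap.lTensor_comp, rightTranslation_apply]
  have : (g.ofConv : A →ₗ[K] K) ∘ₗ (rightTranslation h : A →ₗ[K] A) = ((g * h).ofConv : A →ₗ[K] K) := by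
    ext f; exact point_rightTranslation g h f
  rw [this]

theorem rightTranslation_inv_apply (g : Points K A) (f : A) :
    rightTranslation g⁻¹ (rightTranslation g f) = f := by
  rw [← AlgHom.comp_apply, ← rightTranslation_mul, inv_mul_cancel, rightTranslation_one]; rfl

theorem rightTranslation_apply_inv (g : Points K A) (f : A) :
    rightTranslation g (rightTranslation g⁻¹ f) = f := by
  rw [← AlgHom.comp_apply, ← rightTranslation_mul, mul_inv_cancel, rightTranslation_one]; rfl

/-- Conjugation of a derivation of `K[G]` by a right translation: `ρ_g ∘ D ∘ ρ_g⁻¹`. -/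
noncomputable def conjDerivation (g : Points K A) (D : Derivation K A A) : Derivation K A A :=
  Derivation.mk' ((rightTranslation g : A →ₗ[K] A) ∘ₗ (D : A →ₗ[K] A) ∘ₗ
    (rightTranslation g⁻¹ : A →ₗ[K] A)) (by
      intro a b
      simp [rightTranslation_apply_inv])

theorem conjDerivation_apply (g : Points K A) (D : Derivation K A A) (f : A) :
    conjDerivation g D f = rightTranslation g (D (rightTranslation g⁻¹ f)) := rfl

/-- The adjoint action of `G(K)` on `Lie G`: `Ad(g) D = ρ_g ∘ D ∘ ρ_g⁻¹`. -/
noncomputable def Ad (g : Points K A) : lieAlg K A →ₗ⁅K⁆ lieAlg K A where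
  toFun x := ⟨conjDerivation g x.1, by
      ext f
      change Coalgebra.comul (R := K) (rightTranslation g (x.1 (rightTranslation g⁻¹ f))) =
        LinearMap.lTensor A ((rightTranslation g : A →ₗ[K] A) ∘ₗ (x.1 : A →ₗ[K] A) ∘ₗ
          (rightTranslation g⁻¹ : A →ₗ[K] A)) (Coalgebra.comul f)
      rw [comul_rightTranslation, comul_lieAlg, comul_rightTranslation, LinearMap.lTensor_comp,
        LinearMap.lTensor_comp]
      rfl⟩
  map_add' x y := by
    apply Subtype.ext; ext f
    simp [conjDerivation_apply]
  map_smul' c x := by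
    apply Subtype.ext; ext f
    simp [conjDerivation_apply]
  map_lie' := by
    intro x y
    apply Subtype.ext; ext f
    rw [lieAlg_lie_apply]
    simp only [conjDerivation_apply]
    rw [lieAlg_lie_apply, map_sub, rightTranslation_inv_apply, rightTranslation_inv_apply]

/-- Evaluation of a Laurent polynomial at a unit `t`. -/
noncomputable def laurentEval (t : Kˣ) : K[T;T⁻¹] →ₐ[K] K where
  toRingHom := LaurentPolynomial.eval₂ (RingHom.id K) t
  commutes' r := LaurentPolynomial.eval₂_C (RingHom.id K) t r

/-- A cocharacter `𝔾_m → G` is a bialgebra map `K[G] → K[T, T⁻¹]`; this is its value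
`λ(t) ∈ G(K)`. -/
noncomputable def cocharPoint (c : A →ₐc[K] K[T;T⁻¹]) (t : Kˣ) : Points K A :=
  WithConv.toConv ((laurentEval t).comp (c : A →ₐ[K] K[T;T⁻¹]))

/-- `𝔤(i) = {x | Ad(λ(t)) x = t^i x for all t}`. -/
noncomputable def weightSpace (c : A →ₐc[K] K[T;T⁻¹]) (i : ℤ) : Submodule K (lieAlg K A) where
  carrier := {x | ∀ t : Kˣ, Ad (cocharPoint c t) x = ((t ^ i : Kˣ) : K) • x}
  add_mem' := by
    intro a b ha hb t
    rw [map_add, ha t, hb t, smul_add]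
  zero_mem' := by intro t; simp
  smul_mem' := by
    intro r a ha t
    rw [map_smul, ha t, smul_comm]

theorem lie_mem_weightSpace {c : A →ₐc[K] K[T;T⁻¹]} {i j : ℤ} {x y : lieAlg K A}
    (hx : x ∈ weightSpace c i) (hy : y ∈ weightSpace c j) : ⁅x, y⁆ ∈ weightSpace c (i + j) := by
  intro t
  rw [LieHom.map_lie, hx t, hy t, smul_lie, lie_smul, smul_smul, zpow_add, Units.val_mul]

end AlgebraicGroup

section Induced

variable {K : Type*} [Field K] {B C : Type*} [Ring B] [Algebra K B] [Ring C] [Algebra K C]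

/-- The one-dimensional `B`-module `K_φ` on which `B` acts through `φ : B → K`. -/
def CharModule (_ : B →ₐ[K] K) : Type _ := K

noncomputable instance (φ : B →ₐ[K] K) : AddCommGroup (CharModule φ) :=
  inferInstanceAs (AddCommGroup K)

noncomputable instance (φ : B →ₐ[K] K) : Module K (CharModule φ) :=
  inferInstanceAs (Module K K)

noncomputable instance (φ : B →ₐ[K] K) : Module B (CharModule φ) :=
  Module.compHom K φ.toRingHom

/-- The `C`-submodule of `C ⊗_K M` generated by all `cb ⊗ m - c ⊗ bm`, where `B` acts on `C` on the
right through `f : B → C`. -/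
def balancedRelations (f : B →ₐ[K] C) (M : Type*) [AddCommGroup M] [Module K M] [Module B M] :
    Submodule C (C ⊗[K] M) :=
  Submodule.span C {z | ∃ (c : C) (b : B) (m : M), z = (c * f b) ⊗ₜ[K] m - c ⊗ₜ[K] (b • m)}

/-- The induced module `C ⊗_B M`, a left `C`-module. -/
abbrev InducedModule (f : B →ₐ[K] C) (M : Type*) [AddCommGroup M] [Module K M] [Module B M] :
    Type _ :=
  (C ⊗[K] M) ⧸ balancedRelations f M

end Induced

section PCentre

attribute [local instance 100] LieRing.ofAssociativeRing

variable (p : ℕ) [Fact p.Prime] (K : Type*) [Field K] [CharP K p]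
  (A : Type*) [CommRing A] [HopfAlgebra K A]

variable {K A} in
/-- `ξ(x) = x^p - x^[p]` in the enveloping algebra `U(𝔤)`. -/
noncomputable def xi (x : lieAlg K A) : UniversalEnvelopingAlgebra K (lieAlg K A) :=
  UniversalEnvelopingAlgebra.ι K x ^ p - UniversalEnvelopingAlgebra.ι K (pMap p x)

/-- The `p`-centre `Z_0(𝔤)`, the subalgebra of `U(𝔤)` generated by all `ξ(x)`. -/
noncomputable def pCentre : Subalgebra K (UniversalEnvelopingAlgebra K (lieAlg K A)) :=
  Algebra.adjoin K (Set.range (xi (K := K) (A := A) p))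

variable {K A}

theorem ad_iterate (x y : lieAlg K A) : (fun z => ⁅x, z⁆)^[p] y = ⁅pMap p x, y⁆ := by
  let E : lieAlg K A → Module.End K A := fun z => (z.1 : A →ₗ[K] A)
  have hE : Function.Injective E := fun a b h => by
    apply Subtype.ext; ext f; exact LinearMap.congr_fun h f
  have hlie : ∀ a b, E ⁅a, b⁆ = E a * E b - E b * E a := fun a b => by
    ext f; exact lieAlg_lie_apply a b f
  have hs : Function.Semiconj E (fun z => ⁅x, z⁆) (fun z => E x * z - z * E x) :=
    fun z => hlie x z
  apply hE
  rw [(hs.iterate_right p).eq, commutator_iterate (K := K), hlie]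
  rfl

theorem xi_commute_ι (x y : lieAlg K A) :
    Commute (xi p x) (UniversalEnvelopingAlgebra.ι K y) := by
  have hlie : ∀ a b : lieAlg K A, UniversalEnvelopingAlgebra.ι K ⁅a, b⁆ =
      UniversalEnvelopingAlgebra.ι K a * UniversalEnvelopingAlgebra.ι K b -
      UniversalEnvelopingAlgebra.ι K b * UniversalEnvelopingAlgebra.ι K a := fun a b => by
    rw [LieHom.map_lie, LieRing.of_associative_ring_bracket]
  have hs : Function.Semiconj (UniversalEnvelopingAlgebra.ι K) (fun z => ⁅x, z⁆)
      (fun z => UniversalEnvelopingAlgebra.ι K x * z - z * UniversalEnvelopingAlgebra.ι K x) :=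
    fun z => hlie x z
  have h := (hs.iterate_right p).eq y
  rw [commutator_iterate (K := K), ad_iterate, hlie] at h
  change _ * _ = _ * _
  rw [xi, sub_mul, mul_sub]
  have h' := sub_eq_sub_iff_sub_eq_sub.1 h.symm
  exact h'

theorem xi_commute (x y : lieAlg K A) : xi p x * xi p y = xi p y * xi p x :=
  (((xi_commute_ι p x y).pow_right p).sub_right (xi_commute_ι p x (pMap p y))).eq

variable (K A) in
theorem pCentre_mul_comm (a b : pCentre p K A) : a * b = b * a := by
  have := Algebra.isMulCommutative_adjoin K (s := Set.range (xi (K := K) (A := A) p)) (by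
    rintro _ ⟨x, rfl⟩ _ ⟨y, rfl⟩
    exact xi_commute p x y)
  exact this.is_comm.comm a b

noncomputable instance : CommRing (pCentre p K A) :=
  { (inferInstance : Ring (pCentre p K A)) with mul_comm := pCentre_mul_comm p K A }

/-- `ξ(x)` as an element of `Z_0(𝔤)`. -/
noncomputable def xiZ (x : lieAlg K A) : pCentre p K A :=
  ⟨xi p x, Algebra.subset_adjoin ⟨x, rfl⟩⟩

/-- The maximal ideal `I_η` of `Z_0(𝔤)` attached to `η ∈ 𝔤*`, generated by the elements
`ξ(x) - η(x)^p`. Under `Z_0(𝔤) = K[(𝔤*)^(1)]` it is the ideal of functions vanishing at `η`. -/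
noncomputable def pointIdeal (η : Module.Dual K (lieAlg K A)) : Ideal (pCentre p K A) :=
  Ideal.span (Set.range fun x => xiZ p x - algebraMap K (pCentre p K A) (η x ^ p))

/-- The ideal of all elements of `Z_0(𝔤) = K[(𝔤*)^(1)]` that vanish at every point of `S ⊆ 𝔤*`. -/
noncomputable def vanishingIdeal (S : Set (Module.Dual K (lieAlg K A))) : Ideal (pCentre p K A) :=
  ⨅ η ∈ S, pointIdeal p η

end PCentre

section GelfandGraev

attribute [local instance 100] LieRing.ofAssociativeRing

variable (p : ℕ) [Fact p.Prime] (K : Type*) [Field K] [CharP K p]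
  (A : Type*) [CommRing A] [HopfAlgebra K A]

/-- The choices that enter the construction of the generalised Gelfand-Graev module: a
non-degenerate `G`-invariant form on `𝔤`, a nilpotent element `e`, a Dynkin torus for `e` and a
maximal totally isotropic subspace `𝔩 ⊆ 𝔤(-1)` for `Φ(x, y) = (e, [x, y])`, on which, if `p = 2`,
moreover `(e, u^[2]) = 0`. -/
structure GelfandGraevData where
  /-- the bilinear form `(·,·)` on `𝔤` -/
  form : LinearMap.BilinForm K (lieAlg K A)
  nondegenerate : form.Nondegenerate
  invariant : ∀ (g : Points K A) (x y : lieAlg K A), form (Ad g x) (Ad g y) = form x y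
  /-- the nilpotent element -/
  e : lieAlg K A
  nilpotent : ∃ n : ℕ, (pMap p)^[n] e = 0
  /-- the Dynkin torus `λ_e : 𝔾_m → G` -/
  cochar : A →ₐc[K] K[T;T⁻¹]
  e_mem : e ∈ weightSpace cochar 2
  centralizer_le : ∀ x : lieAlg K A, ⁅e, x⁆ = 0 → x ∈ ⨆ i : ℤ, ⨆ _ : 0 ≤ i, weightSpace cochar i
  /-- the subspace `𝔩` of `𝔤(-1)` -/
  l : Submodule K (lieAlg K A)
  l_le : l ≤ weightSpace cochar (-1)
  isotropic : ∀ x ∈ l, ∀ y ∈ l, form e ⁅x, y⁆ = 0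
  maximal : ∀ l' : Submodule K (lieAlg K A), l' ≤ weightSpace cochar (-1) →
    (∀ x ∈ l', ∀ y ∈ l', form e ⁅x, y⁆ = 0) → l ≤ l' → l' = l
  char_two : p = 2 → ∀ u ∈ l, form e (pMap p u) = 0

namespace GelfandGraevData

variable {p K A} (d : GelfandGraevData p K A)

/-- `χ = (e, ·) ∈ 𝔤*`. -/
noncomputable def chi : Module.Dual K (lieAlg K A) := d.form d.e

/-- The sum of all `𝔤(i)` with `i < -1`. -/
noncomputable def lowerPart : Submodule K (lieAlg K A) :=
  ⨆ i : ℤ, ⨆ _ : i < -1, weightSpace d.cochar i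

theorem lowerPart_induction {P : lieAlg K A → Prop} (h : ∀ i : ℤ, i < -1 →
    ∀ x ∈ weightSpace d.cochar i, P x) (h0 : P 0) (hadd : ∀ x y, P x → P y → P (x + y))
    {x : lieAlg K A} (hx : x ∈ d.lowerPart) : P x := by
  refine Submodule.iSup_induction _ (motive := P) hx (fun i x hx => ?_) h0 hadd
  by_cases hi : i < -1
  · simp only [hi, iSup_pos] at hx
    exact h i hi x hx
  · simp only [hi, iSup_neg, not_false_eq_true, Submodule.mem_bot] at hx
    exact hx ▸ h0

theorem mem_lowerPart {i : ℤ} (hi : i < -1) {x : lieAlg K A} (hx : x ∈ weightSpace d.cochar i) :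
    x ∈ d.lowerPart :=
  Submodule.mem_iSup_of_mem i (Submodule.mem_iSup_of_mem hi hx)

theorem lie_mem_of_weight {i : ℤ} (hi : i ≤ -1) {x y : lieAlg K A}
    (hx : x ∈ weightSpace d.cochar i) (hy : y ∈ d.l ⊔ d.lowerPart) : ⁅x, y⁆ ∈ d.lowerPart := by
  obtain ⟨a, ha, b, hb, rfl⟩ := Submodule.mem_sup.1 hy
  rw [lie_add]
  refine add_mem (d.mem_lowerPart (by omega) (lie_mem_weightSpace hx (d.l_le ha))) ?_
  refine d.lowerPart_induction (P := fun b => ⁅x, b⁆ ∈ d.lowerPart) ?_ ?_ ?_ hb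
  · exact fun j hj z hz => d.mem_lowerPart (by omega) (lie_mem_weightSpace hx hz)
  · simp
  · intro u v hu hv
    rw [lie_add]; exact add_mem hu hv

/-- The subalgebra `𝔪 = 𝔩 ⊕ ∑_{i < -1} 𝔤(i)`. -/
noncomputable def m : LieSubalgebra K (lieAlg K A) where
  toSubmodule := d.l ⊔ d.lowerPart
  lie_mem' := by
    intro x y hx hy
    change ⁅x, y⁆ ∈ d.l ⊔ d.lowerPart
    obtain ⟨a, ha, b, hb, rfl⟩ := Submodule.mem_sup.1 hx
    rw [add_lie]
    refine Submodule.mem_sup_right (add_mem (d.lie_mem_of_weight le_rfl (d.l_le ha) hy) ?_)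
    refine d.lowerPart_induction (P := fun b => ⁅b, y⁆ ∈ d.lowerPart) ?_ ?_ ?_ hb
    · exact fun j hj z hz => d.lie_mem_of_weight (by omega) hz hy
    · simp
    · intro u v hu hv
      rw [add_lie]; exact add_mem hu hv

/-- `𝔪^⊥ = {ψ ∈ 𝔤* | ψ(𝔪) = 0}`. -/
noncomputable def mPerp : Submodule K (Module.Dual K (lieAlg K A)) :=
  d.m.toSubmodule.dualAnnihilator

/-- The ideal `I(𝔪)` of functions in `Z_0(𝔤)` vanishing on `χ + 𝔪^⊥`. -/
noncomputable def I : Ideal (pCentre p K A) :=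
  vanishingIdeal p {η | ∃ ψ ∈ d.mPerp, η = d.chi + ψ}

/-- The homomorphism `U(𝔪) → U(𝔤)` extending the inclusion `𝔪 ⊆ 𝔤`. -/
noncomputable def inclU :
    UniversalEnvelopingAlgebra K d.m →ₐ[K] UniversalEnvelopingAlgebra K (lieAlg K A) :=
  UniversalEnvelopingAlgebra.lift K ((UniversalEnvelopingAlgebra.ι K).comp d.m.incl)

variable [Infinite K]

theorem chi_eq_zero {i : ℤ} (hi : i ≠ -2) {x : lieAlg K A} (hx : x ∈ weightSpace d.cochar i) :
    d.chi x = 0 := by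
  obtain ⟨t, ht⟩ : ∃ t : Kˣ, t ^ (2 + i) ≠ 1 := by
    by_contra! hall
    have h1 : ∀ t : Kˣ, t ^ (2 + i).natAbs = 1 := fun t => by
      rcases Int.natAbs_eq (2 + i) with h | h
      · have := hall t
        rw [h, zpow_natCast] at this; exact this
      · have := hall t
        rw [h, zpow_neg, inv_eq_one, zpow_natCast] at this; exact this
    have hn : 0 < (2 + i).natAbs := by omega
    have hfin : ({0} ∪ {a : K | a ∈ Polynomial.nthRoots (2 + i).natAbs (1 : K)}).Finite :=
      (Set.finite_singleton 0).union (Multiset.finite_toSet _)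
    refine Set.infinite_univ (α := K) (hfin.subset fun a _ => ?_)
    by_cases ha : a = 0
    · exact Or.inl ha
    · refine Or.inr ((Polynomial.mem_nthRoots hn).2 ?_)
      simpa using congrArg Units.val (h1 (Units.mk0 a ha))
  have h := d.invariant (cocharPoint d.cochar t) d.e x
  rw [d.e_mem t, hx t, map_smul, map_smul, LinearMap.smul_apply, smul_smul, smul_eq_mul,
    ← Units.val_mul, ← zpow_add, add_comm i] at h
  have h2 : (((t ^ (2 + i) : Kˣ) : K) - 1) * d.form d.e x = 0 := by
    rw [sub_mul, h, one_mul, sub_self]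
  rcases mul_eq_zero.1 h2 with h3 | h3
  · exact absurd (Units.ext (sub_eq_zero.1 h3)) ht
  · exact h3

theorem chi_lie_weight {i : ℤ} (hi : i < -1) {x y : lieAlg K A}
    (hx : x ∈ weightSpace d.cochar i) (hy : y ∈ d.m) : d.chi ⁅x, y⁆ = 0 := by
  obtain ⟨a, ha, b, hb, rfl⟩ := Submodule.mem_sup.1 hy
  rw [lie_add, map_add, d.chi_eq_zero (by omega) (lie_mem_weightSpace hx (d.l_le ha)), zero_add]
  refine d.lowerPart_induction (P := fun b => d.chi ⁅x, b⁆ = 0) ?_ ?_ ?_ hb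
  · exact fun j hj z hz => d.chi_eq_zero (by omega) (lie_mem_weightSpace hx hz)
  · simp
  · intro u v hu hv
    rw [lie_add, map_add, hu, hv, add_zero]

theorem chi_lie_eq_zero {x y : lieAlg K A} (hx : x ∈ d.m) (hy : y ∈ d.m) : d.chi ⁅x, y⁆ = 0 := by
  obtain ⟨a, ha, b, hb, rfl⟩ := Submodule.mem_sup.1 hx
  have h1 : d.chi ⁅b, y⁆ = 0 := by
    refine d.lowerPart_induction (P := fun b => d.chi ⁅b, y⁆ = 0) ?_ ?_ ?_ hb
    · exact fun j hj z hz => d.chi_lie_weight hj hz hy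
    · simp
    · intro u v hu hv
      rw [add_lie, map_add, hu, hv, add_zero]
  obtain ⟨a', ha', b', hb', rfl⟩ := Submodule.mem_sup.1 hy
  have h2 : d.chi ⁅a, b'⁆ = 0 := by
    refine d.lowerPart_induction (P := fun b => d.chi ⁅a, b⁆ = 0) ?_ ?_ ?_ hb'
    · exact fun j hj z hz => d.chi_eq_zero (by omega) (lie_mem_weightSpace (d.l_le ha) hz)
    · simp
    · intro u v hu hv
      rw [lie_add, map_add, hu, hv, add_zero]
  rw [add_lie, map_add, h1, add_zero, lie_add, map_add, h2, add_zero]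
  exact d.isotropic a ha a' ha'

/-- The restriction of `χ` to `𝔪`, a character of `𝔪`. -/
noncomputable def chiM : d.m →ₗ⁅K⁆ K where
  toLinearMap := d.chi ∘ₗ d.m.toSubmodule.subtype
  map_lie' := by
    intro x y
    change d.chi ⁅x.1, y.1⁆ = _
    rw [d.chi_lie_eq_zero x.2 y.2, LieRing.of_associative_ring_bracket, mul_comm, sub_self]

/-- The character of `U(𝔪)` extending `χ|_𝔪`. -/
noncomputable def chiU : UniversalEnvelopingAlgebra K d.m →ₐ[K] K :=
  UniversalEnvelopingAlgebra.lift K d.chiM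

/-- The generalised Gelfand-Graev module `Q_χ = U(𝔤) ⊗_{U(𝔪)} K_χ`. -/
abbrev Q : Type _ := InducedModule d.inclU (CharModule d.chiU)

end GelfandGraevData

end GelfandGraev

end ModularW

/-! Everything rests on a Poincaré-Birkhoff-Witt basis of `U(𝔤)` fitted both to `𝔪` and to the
p-centre. Extend a basis `x_i` of `𝔪` by `y_1, …, y_r` to a basis of `𝔤`. Since `ξ(y)` and `y^p`
have the same leading term, the products of all `ξ(y_j)^(q_j) y_j^(a_j)`, `0 ≤ a_j < p`, followed by
all `(x_i - χ(x_i))^(b_i)` form a basis of `U(𝔤)` (`basisU`). The coordinates with `b = 0` descend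
to `Q_χ` (`coord_mul_inclU`), so `Q_χ` is free over the polynomial ring `P` in the `ξ(y_j)`, with
basis the `p^r` vectors `y^a ⊗ 1` (`expansion_injective`, `expansion_surjective`); here `r` is the
codimension of `𝔪`, which is `dim 𝔪^⊥`.

It remains to identify `P` with `Z_0(𝔤)/I(𝔪)`. Let `J` (`mIdeal`) be generated by the `ξ(x) -
χ(x)^p` with `x ∈ 𝔪`. By Jacobson's formula `ξ` is p-semilinear, so `Z_0(𝔤) = P + J`. The ideal `J`
kills `Q_χ` because `𝔪` is closed under the p-map and `χ(x^[p]) = 0` on it (`pMap_mem_m`). As `P`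
acts faithfully, `J` is the whole annihilator. Clearly `J ⊆ I(𝔪)`. Conversely, if `z ∈ I(𝔪)` is
congruent to `f ∈ P` modulo `J`, then `f` vanishes at every point of `K^r`: over an algebraically
closed field each point has the form `(η(y_j)^p)` with `η ∈ χ + 𝔪^⊥`. So `f = 0`, and the three
ideals agree.

The independence half of PBW is obtained concretely for `Lie G`: it acts on `K[G][T]` by derivations
twisted by `exp(∑ T_i a_i)`, where the functions `a_i` are dual to a basis of `𝔤` at the identity,
and the leading coefficients of `u · 1` at the identity separate monomials. -/

namespace ModularW

/-! ### Jacobson's formula in characteristic `p`. -/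

section Jacobson

/-- The coefficients of `ad(xT + y)^n (x)` as a polynomial in `T` with coefficients in a Lie ring. -/
def adCoeff {L : Type*} [LieRing L] (x y : L) : ℕ → ℕ → L
  | 0, 0 => x
  | 0, _ + 1 => 0
  | n + 1, 0 => ⁅y, adCoeff x y n 0⁆
  | n + 1, i + 1 => ⁅x, adCoeff x y n i⁆ + ⁅y, adCoeff x y n (i + 1)⁆

/-- The Lie polynomial `(x + y)^p - x^p - y^p`. -/
def jacobsonSum (K : Type*) [Field K] {L : Type*} [LieRing L] [LieAlgebra K L] (p : ℕ) (x y : L) :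
    L :=
  ∑ i ∈ Finset.range (p - 1), ((i + 1 : ℕ) : K)⁻¹ • adCoeff x y (p - 1) i

/-- Since `p - 1 ≥ 1`, every term is a multiple of an iterated bracket. Two subspaces are allowed so
that `N` can be the part of `𝔪` killed by `χ`. -/
theorem jacobsonSum_mem {K L : Type*} [Field K] [LieRing L] [LieAlgebra K L] (p : ℕ)
    (hp : 2 ≤ p) {M : Submodule K L} {N : Submodule K L}
    (hMN : ∀ x ∈ M, ∀ y ∈ M, ⁅x, y⁆ ∈ N) (hN : N ≤ M) {x y : L} (hx : x ∈ M) (hy : y ∈ M) :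
    jacobsonSum K p x y ∈ N := by
  have h0 : ∀ n i, adCoeff x y n i ∈ M := by
    intro n
    induction n with
    | zero =>
      rintro (_ | i)
      · exact hx
      · exact zero_mem _
    | succ n ih =>
      rintro (_ | i)
      · exact hN (hMN _ hy _ (ih _))
      · exact hN (add_mem (hMN _ hx _ (ih _)) (hMN _ hy _ (ih _)))
  have h1 : ∀ n i, adCoeff x y (n + 1) i ∈ N := by
    rintro n (_ | i)
    · exact hMN _ hy _ (h0 _ _)
    · exact add_mem (hMN _ hx _ (h0 _ _)) (hMN _ hy _ (h0 _ _))
  obtain ⟨q, rfl⟩ := Nat.exists_eq_add_of_le' hp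
  exact sum_mem fun i _ => N.smul_mem _ (h1 _ _)

theorem natCast_char_eq_zero (K : Type*) [Field K] (p : ℕ) [CharP K p] (S : Type*) [Ring S]
    [Algebra K S] : ((p : ℕ) : S) = 0 := by
  rw [← map_natCast (algebraMap K S) p, CharP.cast_eq_zero, map_zero]

/-- By Pascal's rule neighbouring entries of row `p - 1` add up to an entry of row `p`, which is
zero modulo `p`; so the signs alternate. -/
theorem cast_choose_pred (K : Type*) [Field K] (p : ℕ) [Fact p.Prime] [CharP K p]
    (S : Type*) [Ring S] [Algebra K S] (j : ℕ) (hj : j < p) :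
    ((p - 1).choose j : S) = (-1) ^ j := by
  induction j with
  | zero => simp
  | succ j ih =>
    have hp : p = (p - 1) + 1 := (Nat.succ_pred_prime Fact.out).symm
    have h : ((p.choose (j + 1) : ℕ) : S) = 0 := by
      obtain ⟨c, hc⟩ := (Fact.out : p.Prime).dvd_choose_self (Nat.succ_ne_zero j) hj
      rw [hc, Nat.cast_mul, natCast_char_eq_zero K p S, zero_mul]
    rw [hp, Nat.choose_succ_succ, Nat.cast_add, ih (by omega)] at h
    rw [pow_succ, mul_neg_one, eq_neg_iff_add_eq_zero, add_comm]
    exact h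

/-- The last entry of row `p - 1` is `1`; reading the sign there treats `p = 2` and odd `p` alike.
-/
theorem neg_one_pow_char_pred (K : Type*) [Field K] (p : ℕ) [Fact p.Prime] [CharP K p]
    (S : Type*) [Ring S] [Algebra K S] : (-1 : S) ^ (p - 1) = 1 := by
  rw [← cast_choose_pred K p S (p - 1) (Nat.sub_lt (Fact.out : p.Prime).pos one_pos),
    Nat.choose_self, Nat.cast_one]

/-- Applied to left and right multiplication by `a`, this turns the noncommutative derivative of
`a^p` into `ad(a)^(p-1)` of the derivative of `a`. -/
theorem commute_sub_pow_pred (K : Type*) [Field K] (p : ℕ) [Fact p.Prime] [CharP K p]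
    {S : Type*} [Ring S] [Algebra K S] {a b : S} (h : Commute a b) :
    (a - b) ^ (p - 1) = ∑ j ∈ Finset.range p, a ^ j * b ^ (p - 1 - j) := by
  have hp : (p - 1) + 1 = p := Nat.succ_pred_prime Fact.out
  rw [sub_eq_add_neg, h.neg_right.add_pow, hp]
  refine Finset.sum_congr rfl fun j hj => ?_
  rw [Finset.mem_range] at hj
  rw [cast_choose_pred K p S j hj, neg_pow, mul_assoc, mul_assoc,
    ((Commute.neg_one_left (b ^ (p - 1 - j))).pow_left j).eq.symm, ← mul_assoc ((-1) ^ _),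
    ← pow_add, Nat.sub_add_cancel (by omega), neg_one_pow_char_pred K p S, one_mul]

theorem derivative_pow_eq_sum {S : Type*} [Ring S] (a : Polynomial S) (n : ℕ) :
    Polynomial.derivative (a ^ n) =
      ∑ j ∈ Finset.range n, a ^ j * Polynomial.derivative a * a ^ (n - 1 - j) := by
  induction n with
  | zero => simp
  | succ n ih =>
    rw [pow_succ, Polynomial.derivative_mul, ih, Finset.sum_range_succ, Finset.sum_mul]
    congr 1
    · refine Finset.sum_congr rfl fun j hj => ?_
      rw [Finset.mem_range] at hj
      rw [mul_assoc, ← pow_succ]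
      congr 2
      omega
    · simp

variable {K : Type*} [Field K] (p : ℕ) [Fact p.Prime] [CharP K p]
  {L : Type*} [LieRing L] [LieAlgebra K L] {S : Type*} [Ring S] [Algebra K S]

/-- **Jacobson's formula** for the `p`-th power of a sum in characteristic `p`. -/
theorem add_pow_char_jacobson (φ : L →ₗ[K] S) (hφ : ∀ x y, φ ⁅x, y⁆ = φ x * φ y - φ y * φ x)
    (x y : L) :
    (φ x + φ y) ^ p = φ x ^ p + φ y ^ p + φ (jacobsonSum K p x y) := by
  have hp : (p - 1) + 1 = p := Nat.succ_pred_prime Fact.out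
  let a : Polynomial S := Polynomial.C (φ x) * Polynomial.X + Polynomial.C (φ y)
  let b : Polynomial S := Polynomial.C (φ x)
  have hda : Polynomial.derivative a = b := by simp [a, b]
  let E : Module.End K (Polynomial S) := LinearMap.mulLeft K a - LinearMap.mulRight K a
  have hE : ∀ z, E z = a * z - z * a := fun z => rfl
  have hcoeff : ∀ n i, ((E ^ n) b).coeff i = φ (adCoeff x y n i) := by
    intro n
    induction n with
    | zero =>
      rintro (_ | i)
      · simp [b, adCoeff]
      · simp [b, adCoeff]
    | succ n ih =>
      intro i
      rw [pow_succ', Module.End.mul_apply, hE]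
      rcases i with _ | i
      · simp only [a, Polynomial.coeff_sub, add_mul, mul_add, Polynomial.coeff_add, mul_assoc,
          Polynomial.coeff_C_mul, Polynomial.coeff_mul_C, ih, adCoeff, hφ]
        simp [Polynomial.X_mul, ← mul_assoc, ih]
      · simp only [a, Polynomial.coeff_sub, add_mul, mul_add, Polynomial.coeff_add, mul_assoc,
          Polynomial.coeff_C_mul, Polynomial.coeff_mul_C, adCoeff, hφ, map_add]
        rw [Polynomial.X_mul,
          ← mul_assoc]
        simp only [Polynomial.coeff_mul_X, Polynomial.coeff_mul_C, ih]
        abel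
  have hder : Polynomial.derivative (a ^ p) = (E ^ (p - 1)) b := by
    rw [derivative_pow_eq_sum, hda, commute_sub_pow_pred K p
      (LinearMap.commute_mulLeft_right (R := K) a a)]
    simp only [LinearMap.sum_apply, Module.End.mul_apply, LinearMap.pow_mulLeft,
      LinearMap.pow_mulRight, LinearMap.mulLeft_apply, LinearMap.mulRight_apply, mul_assoc]
  -- The coefficient of `T^i` in the derivative of `a^p` is `i + 1` times that of `T^(i+1)` in
  -- `a^p`, and `i + 1 < p` is invertible in `K`.
  have hmid : ∀ i ∈ Finset.range (p - 1),
      (a ^ p).coeff (i + 1) = φ (((i + 1 : ℕ) : K)⁻¹ • adCoeff x y (p - 1) i) := by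
    intro i hi
    rw [Finset.mem_range] at hi
    have h := congrArg (fun f => Polynomial.coeff f i) hder
    simp only [Polynomial.coeff_derivative, hcoeff] at h
    have hne : ((i + 1 : ℕ) : K) ≠ 0 := by
      rw [Ne, CharP.cast_eq_zero_iff K p]
      exact Nat.not_dvd_of_pos_of_lt (Nat.succ_pos i) (by omega)
    rw [map_smul, ← h, eq_inv_smul_iff₀ hne, Algebra.smul_def, map_natCast, Nat.cast_add_one]
    exact (Nat.cast_add_one (R := S) i ▸ Nat.cast_commute (i + 1) _ :)
  have hdeg : a.natDegree ≤ 1 := by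
    refine (Polynomial.natDegree_add_le _ _).trans (max_le ?_ (by simp))
    exact (Polynomial.natDegree_C_mul_le _ _).trans Polynomial.natDegree_X_le
  have h0 : (a ^ p).coeff 0 = φ y ^ p := by
    rw [← Polynomial.constantCoeff_apply, map_pow]
    simp [a]
  have htop : (a ^ p).coeff p = φ x ^ p := by
    have := Polynomial.coeff_pow_of_natDegree_le (m := p) hdeg
    rw [mul_one] at this
    rw [this]
    simp [a, Polynomial.coeff_C]
  have hev : (a ^ p).eval 1 = (φ x + φ y) ^ p := by
    -- Evaluation over the noncommutative ring `S` is multiplicative here because `1` is central.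
    let ev := Polynomial.eval₂RingHom' (RingHom.id S) 1 (fun s => Commute.one_right s)
    change ev (a ^ p) = _
    rw [map_pow]
    congr 1
    simp [ev, a]
  rw [← hev, Polynomial.eval_eq_sum_range' (n := p + 1)
    (Nat.lt_succ_of_le ((Polynomial.natDegree_pow_le).trans (by nlinarith))),
    Finset.sum_range_succ]
  simp only [one_pow, mul_one, htop]
  rw [← hp, Finset.sum_range_succ', hp, h0, Finset.sum_congr rfl hmid, jacobsonSum, map_sum]
  abel

end Jacobson

/-! ### The p-map on `Lie G`, semilinearity of `ξ`, and stability of `𝔪`. -/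

section PMap

attribute [local instance 100] LieRing.ofAssociativeRing

variable (p : ℕ) [Fact p.Prime] {K : Type*} [Field K] [CharP K p]
  {A : Type*} [CommRing A] [HopfAlgebra K A]

/-- The inclusion of `Lie G` into the endomorphisms of `K[G]`. -/
def toEnd : lieAlg K A →ₗ[K] Module.End K A where
  toFun x := (x.1 : A →ₗ[K] A)
  map_add' _ _ := rfl
  map_smul' _ _ := rfl

theorem toEnd_injective : Function.Injective (toEnd (K := K) (A := A)) := fun a b h => by
  apply Subtype.ext; ext f; exact LinearMap.congr_fun h f

theorem toEnd_pMap (x : lieAlg K A) : toEnd (pMap p x) = toEnd x ^ p := rfl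

theorem pMap_add (x y : lieAlg K A) :
    pMap p (x + y) = pMap p x + pMap p y + jacobsonSum K p x y := by
  apply toEnd_injective
  rw [toEnd_pMap, map_add, map_add, map_add, toEnd_pMap, toEnd_pMap]
  exact add_pow_char_jacobson p toEnd (fun a b => by ext f; exact lieAlg_lie_apply a b f) x y

theorem pMap_smul (c : K) (x : lieAlg K A) : pMap p (c • x) = c ^ p • pMap p x := by
  apply toEnd_injective
  rw [toEnd_pMap, map_smul, map_smul, toEnd_pMap, smul_pow]

theorem pMap_zero : pMap p (0 : lieAlg K A) = 0 := by
  have := pMap_smul p (0 : K) (0 : lieAlg K A)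
  rwa [zero_smul, zero_pow (Fact.out : p.Prime).ne_zero, zero_smul] at this

theorem ι_lie (x y : lieAlg K A) : UniversalEnvelopingAlgebra.ι K ⁅x, y⁆ =
    UniversalEnvelopingAlgebra.ι K x * UniversalEnvelopingAlgebra.ι K y -
      UniversalEnvelopingAlgebra.ι K y * UniversalEnvelopingAlgebra.ι K x := by
  rw [LieHom.map_lie, LieRing.of_associative_ring_bracket]

/-- The Jacobson correction is the same Lie polynomial in `U(𝔤)` and in `End K[G]`, so it cancels
between `x^p` and `x^[p]`. -/
theorem xi_add (x y : lieAlg K A) : xi p (x + y) = xi p x + xi p y := by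
  have h := add_pow_char_jacobson p
    (UniversalEnvelopingAlgebra.ι K : lieAlg K A →ₗ⁅K⁆ _).toLinearMap ι_lie x y
  simp only [LieHom.coe_toLinearMap] at h
  simp only [xi, map_add, pMap_add]
  rw [h]
  abel

theorem xi_smul (c : K) (x : lieAlg K A) : xi p (c • x) = c ^ p • xi p x := by
  simp only [xi, map_smul, pMap_smul, smul_pow, smul_sub]

theorem xiZ_add (x y : lieAlg K A) : xiZ p (x + y) = xiZ p x + xiZ p y :=
  Subtype.ext (xi_add p x y)

theorem xiZ_smul (c : K) (x : lieAlg K A) : xiZ p (c • x) = c ^ p • xiZ p x :=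
  Subtype.ext (xi_smul p c x)

theorem Ad_pMap (g : Points K A) (x : lieAlg K A) : Ad g (pMap p x) = pMap p (Ad g x) := by
  apply Subtype.ext
  ext f
  change rightTranslation g ((toEnd x ^ p) (rightTranslation g⁻¹ f)) = (toEnd (Ad g x) ^ p) f
  have h : ∀ n : ℕ, ∀ f, rightTranslation g ((toEnd x ^ n) (rightTranslation g⁻¹ f)) =
      (toEnd (Ad g x) ^ n) f := by
    intro n
    induction n with
    | zero => intro f; exact rightTranslation_apply_inv g f
    | succ n ih =>
      intro f
      rw [pow_succ, pow_succ, Module.End.mul_apply, Module.End.mul_apply, ← ih]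
      congr 2
      exact (rightTranslation_inv_apply g _).symm
  exact h p f

theorem pMap_mem_weightSpace {c : A →ₐc[K] K[T;T⁻¹]} {i : ℤ} {x : lieAlg K A}
    (hx : x ∈ weightSpace c i) : pMap p x ∈ weightSpace c (p * i) := by
  intro t
  rw [Ad_pMap, hx t, pMap_smul, mul_comm, zpow_mul, zpow_natCast, Units.val_pow_eq_pow_val]

namespace GelfandGraevData

variable {p} (d : GelfandGraevData p K A)

theorem jacobsonSum_mem_m [Infinite K] {x y : lieAlg K A} (hx : x ∈ d.m) (hy : y ∈ d.m) :
    jacobsonSum K p x y ∈ d.m ∧ d.chi (jacobsonSum K p x y) = 0 :=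
  jacobsonSum_mem p (Fact.out : p.Prime).two_le (M := d.m.toSubmodule)
    (N := d.m.toSubmodule ⊓ LinearMap.ker d.chi)
    (fun _ hx _ hy => ⟨d.m.lie_mem hx hy, d.chi_lie_eq_zero hx hy⟩) inf_le_left hx hy

/-- `𝔪` is stable under the `p`-map, and `χ` vanishes on the image. -/
theorem pMap_mem_m [Infinite K] {x : lieAlg K A} (hx : x ∈ d.m) :
    pMap p x ∈ d.m ∧ d.chi (pMap p x) = 0 := by
  have hp := (Fact.out : p.Prime).two_le
  have hadd : ∀ x y, (x ∈ d.m ∧ pMap p x ∈ d.m ∧ d.chi (pMap p x) = 0) →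
      (y ∈ d.m ∧ pMap p y ∈ d.m ∧ d.chi (pMap p y) = 0) →
      (x + y ∈ d.m ∧ pMap p (x + y) ∈ d.m ∧ d.chi (pMap p (x + y)) = 0) := by
    rintro x y ⟨hx, hx1, hx2⟩ ⟨hy, hy1, hy2⟩
    obtain ⟨hj1, hj2⟩ := d.jacobsonSum_mem_m hx hy
    rw [pMap_add]
    exact ⟨add_mem hx hy, add_mem (add_mem hx1 hy1) hj1,
      by rw [map_add, map_add, hx2, hy2, hj2]; simp⟩
  obtain ⟨a, ha, b, hb, rfl⟩ := Submodule.mem_sup.1 hx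
  refine (hadd a b ?_ ?_).2
  · have h := pMap_mem_weightSpace p (d.l_le ha)
    refine ⟨Submodule.mem_sup_left ha,
      Submodule.mem_sup_right (d.mem_lowerPart (by omega) h), ?_⟩
    -- `a^[p]` has weight `-p`, and `χ` vanishes off weight `-2`. Only `p = 2` needs the extra
    -- condition on `𝔩`.
    by_cases h2 : p = 2
    · exact d.char_two h2 a ha
    · exact d.chi_eq_zero (by omega) h
  · refine d.lowerPart_induction (P := fun b => b ∈ d.m ∧ pMap p b ∈ d.m ∧
      d.chi (pMap p b) = 0) ?_ ?_ hadd hb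
    · intro i hi z hz
      have h := pMap_mem_weightSpace p hz
      have h4 : (p : ℤ) * i ≤ -4 := by nlinarith
      exact ⟨Submodule.mem_sup_right (d.mem_lowerPart hi hz),
        Submodule.mem_sup_right (d.mem_lowerPart (by omega) h), d.chi_eq_zero (by omega) h⟩
    · rw [pMap_zero]
      exact ⟨zero_mem _, zero_mem _, map_zero _⟩

end GelfandGraevData

end PMap

/-! ### The degree filtration of an enveloping algebra, leading symbols, and PBW criteria. -/

section Filtration

attribute [local instance 100] LieRing.ofAssociativeRing

open UniversalEnvelopingAlgebra

variable {K : Type*} [Field K] {L : Type*} [LieRing L] [LieAlgebra K L]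

/-- The elements satisfying `P` form a subalgebra containing `L`; the map that `lift` gives into it,
followed by the inclusion, fixes the generators and so is the identity. -/
theorem ue_induction {P : UniversalEnvelopingAlgebra K L → Prop}
    (halg : ∀ r : K, P (algebraMap K _ r)) (hι : ∀ x, P (ι K x))
    (hadd : ∀ a b, P a → P b → P (a + b)) (hmul : ∀ a b, P a → P b → P (a * b))
    (u : UniversalEnvelopingAlgebra K L) : P u := by
  let S : Subalgebra K (UniversalEnvelopingAlgebra K L) :=
    { carrier := {u | P u}
      add_mem' := fun ha hb => hadd _ _ ha hb
      mul_mem' := fun ha hb => hmul _ _ ha hb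
      algebraMap_mem' := halg }
  let j : L →ₗ⁅K⁆ S :=
    { toFun := fun x => ⟨ι K x, hι x⟩
      map_add' := fun x y => Subtype.ext (map_add _ x y)
      map_smul' := fun c x => Subtype.ext (map_smul _ c x)
      map_lie' := fun {x y} => Subtype.ext (LieHom.map_lie _ x y) }
  have h : S.val.comp (lift K j) = AlgHom.id K _ := by
    ext x
    simp [j]
  have := DFunLike.congr_fun h u
  change ((lift K j u : S) : UniversalEnvelopingAlgebra K L) = u at this
  rw [← this]
  exact (lift K j u).2

variable (K L) in
/-- The span of all products of fewer than `k` elements of `L` in the enveloping algebra. -/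
def fil (k : ℕ) : Submodule K (UniversalEnvelopingAlgebra K L) :=
  Submodule.span K {u | ∃ l : List L, l.length < k ∧ (l.map (ι K)).prod = u}

theorem prod_mem_fil (l : List L) {k : ℕ} (h : l.length < k) : (l.map (ι K)).prod ∈ fil K L k :=
  Submodule.subset_span ⟨l, h, rfl⟩

theorem fil_mono {i j : ℕ} (h : i ≤ j) : fil K L i ≤ fil K L j :=
  Submodule.span_mono fun _ ⟨l, hl, e⟩ => ⟨l, hl.trans_le h, e⟩

/-- Lengths at most `i - 1` and `j - 1` add up to at most `i + j - 2`, which explains the shift in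
the hypothesis. -/
theorem mul_mem_fil {i j k : ℕ} (h : i + j ≤ k + 1) {a b : UniversalEnvelopingAlgebra K L}
    (ha : a ∈ fil K L i) (hb : b ∈ fil K L j) : a * b ∈ fil K L k := by
  have := Submodule.mul_mem_mul ha hb
  rw [fil, fil, Submodule.span_mul_span] at this
  refine Submodule.span_le.2 ?_ this
  rintro _ ⟨_, ⟨l, hl, rfl⟩, _, ⟨l', hl', rfl⟩, rfl⟩
  simp only [SetLike.mem_coe]
  rw [← List.prod_append, ← List.map_append]
  exact prod_mem_fil _ (by rw [List.length_append]; omega)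

theorem ι_mem_fil (x : L) {k : ℕ} (hk : 2 ≤ k) : ι K x ∈ fil K L k := by
  simpa using prod_mem_fil (K := K) [x] (k := k) (by simp; omega)

theorem one_mem_fil {k : ℕ} (hk : 1 ≤ k) : (1 : UniversalEnvelopingAlgebra K L) ∈ fil K L k := by
  simpa using prod_mem_fil (K := K) ([] : List L) (k := k) (by simp; omega)

theorem exists_mem_fil (u : UniversalEnvelopingAlgebra K L) : ∃ k, u ∈ fil K L k := by
  induction u using ue_induction with
  | halg r =>
    rw [Algebra.algebraMap_eq_smul_one]
    exact ⟨1, Submodule.smul_mem _ _ (one_mem_fil le_rfl)⟩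
  | hι x => exact ⟨2, ι_mem_fil x le_rfl⟩
  | hadd a b ha hb =>
    obtain ⟨i, hi⟩ := ha
    obtain ⟨j, hj⟩ := hb
    exact ⟨max i j, add_mem (fil_mono (le_max_left _ _) hi) (fil_mono (le_max_right _ _) hj)⟩
  | hmul a b ha hb =>
    obtain ⟨i, hi⟩ := ha
    obtain ⟨j, hj⟩ := hb
    exact ⟨i + j, mul_mem_fil (by omega) hi hj⟩

/-- Exchanging two neighbours costs a bracket, that is, a product with one factor fewer. -/
theorem prod_sub_prod_mem_fil {l l' : List L} (h : l.Perm l') :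
    (l.map (ι K)).prod - (l'.map (ι K)).prod ∈ fil K L l.length := by
  induction h with
  | nil => simp
  | cons x h ih =>
    simp only [List.map_cons, List.prod_cons, ← mul_sub]
    exact mul_mem_fil (by simp; omega) (ι_mem_fil x le_rfl) ih
  | swap x y l =>
    have hlie : ι K ⁅y, x⁆ = ι K y * ι K x - ι K x * ι K y := by
      rw [LieHom.map_lie, LieRing.of_associative_ring_bracket]
    simp only [List.map_cons, List.prod_cons, ← mul_assoc, ← sub_mul, ← hlie]
    simpa using prod_mem_fil (K := K) (⁅y, x⁆ :: l) (k := l.length + 2) (by simp)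
  | trans h₁ _ ih₁ ih₂ =>
    rw [← sub_add_sub_cancel]
    exact add_mem ih₁ (h₁.length_eq ▸ ih₂)

variable {κ : Type*} (v : κ → L)

/-- `u` agrees, up to terms of smaller degree, with the product of the `v j`, `j ∈ α`. -/
def HasSymbol (α : Multiset κ) (u : UniversalEnvelopingAlgebra K L) : Prop :=
  u - (α.toList.map fun j => ι K (v j)).prod ∈ fil K L (Multiset.card α)

variable {v}

/-- The order chosen by `Multiset.toList` is immaterial, since reordering changes a product only in
lower degree. -/
theorem hasSymbol_coe {l : List κ} {u : UniversalEnvelopingAlgebra K L} :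
    HasSymbol v (l : Multiset κ) u ↔ u - (l.map fun j => ι K (v j)).prod ∈ fil K L l.length := by
  have h : (l : Multiset κ).toList.Perm l := Multiset.coe_eq_coe.1 (Multiset.coe_toList _)
  have h' := prod_sub_prod_mem_fil (K := K) (h.map v)
  rw [List.map_map, List.map_map, List.length_map, h.length_eq] at h'
  rw [HasSymbol, Multiset.coe_card]
  constructor
  · intro hu
    rw [← sub_add_sub_cancel]
    exact add_mem hu h'
  · intro hu
    rw [← sub_sub_sub_cancel_right _ _ (l.map fun j => ι K (v j)).prod]
    exact sub_mem hu h'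

theorem HasSymbol.sub_lower {α : Multiset κ} {u w : UniversalEnvelopingAlgebra K L}
    (h : HasSymbol v α u) (hw : w ∈ fil K L (Multiset.card α)) : HasSymbol v α (u - w) := by
  rw [HasSymbol, sub_right_comm]
  exact sub_mem h hw

theorem HasSymbol.mem_fil {α : Multiset κ} {u : UniversalEnvelopingAlgebra K L}
    (h : HasSymbol v α u) {k : ℕ} (hk : Multiset.card α < k) : u ∈ fil K L k := by
  rw [← sub_add_cancel u (α.toList.map fun j => ι K (v j)).prod]
  refine add_mem (fil_mono hk.le h) ?_
  simpa using! prod_mem_fil (K := K) (α.toList.map v) (k := k) (by simpa using hk)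

theorem hasSymbol_one : HasSymbol v 0 (1 : UniversalEnvelopingAlgebra K L) := by
  simp [HasSymbol]

theorem hasSymbol_ι (j : κ) : HasSymbol v {j} (ι K (v j)) := by
  simp [HasSymbol]

theorem HasSymbol.mul {α β : Multiset κ} {a b : UniversalEnvelopingAlgebra K L}
    (ha : HasSymbol v α a) (hb : HasSymbol v β b) : HasSymbol v (α + β) (a * b) := by
  have ha' := ha
  have hb' := hb
  have e : α + β = ((α.toList ++ β.toList : List κ) : Multiset κ) := by
    rw [← Multiset.coe_add, Multiset.coe_toList, Multiset.coe_toList]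
  rw [e, hasSymbol_coe, List.map_append, List.prod_append, List.length_append,
    Multiset.length_toList, Multiset.length_toList]
  rw [HasSymbol] at ha' hb'
  set s := (α.toList.map fun j => ι K (v j)).prod
  set t := (β.toList.map fun j => ι K (v j)).prod
  have hsm : s ∈ fil K L (Multiset.card α + 1) := by
    simpa using! prod_mem_fil (K := K) (α.toList.map v) (k := Multiset.card α + 1) (by simp)
  have e2 : a * b - s * t = (a - s) * b + s * (b - t) := by noncomm_ring
  rw [e2]
  exact add_mem (mul_mem_fil (by omega) ha' (hb.mem_fil (Nat.lt_succ_self _)))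
    (mul_mem_fil (by omega) hsm hb')

theorem HasSymbol.pow {α : Multiset κ} {a : UniversalEnvelopingAlgebra K L}
    (ha : HasSymbol v α a) (n : ℕ) : HasSymbol v (n • α) (a ^ n) := by
  induction n with
  | zero => simpa using hasSymbol_one
  | succ n ih =>
    rw [succ_nsmul, pow_succ]
    exact ih.mul ha

theorem hasSymbol_list_prod {σ : Type*} {α : σ → Multiset κ}
    {a : σ → UniversalEnvelopingAlgebra K L} (h : ∀ s, HasSymbol v (α s) (a s)) (l : List σ) :
    HasSymbol v (l.map α).sum (l.map a).prod := by
  induction l with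
  | nil => exact hasSymbol_one
  | cons s l ih =>
    simp only [List.map_cons, List.sum_cons, List.prod_cons]
    exact (h s).mul ih

theorem list_prod_mem_span_basis (b : Module.Basis κ K L) (l : List L) :
    (l.map (ι K)).prod ∈ Submodule.span K {u | ∃ l' : List κ, l'.length = l.length ∧
      (l'.map fun j => ι K (b j)).prod = u} := by
  induction l with
  | nil => exact Submodule.subset_span ⟨[], rfl, rfl⟩
  | cons x l ih =>
    have hx : ι K x ∈ Submodule.span K (Set.range fun j => ι K (b j)) := by
      have h : x ∈ Submodule.span K (Set.range b) := b.mem_span x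
      have := Submodule.mem_map_of_mem
        (f := (ι K : L →ₗ⁅K⁆ UniversalEnvelopingAlgebra K L).toLinearMap) h
      rw [Submodule.map_span, ← Set.range_comp] at this
      exact this
    have := Submodule.mul_mem_mul hx ih
    rw [Submodule.span_mul_span] at this
    rw [List.map_cons, List.prod_cons]
    refine Submodule.span_mono ?_ this
    rintro _ ⟨_, ⟨j, rfl⟩, _, ⟨l', hl', rfl⟩, rfl⟩
    exact ⟨j :: l', by simp [hl'], by simp⟩

/-- The spanning half of the Poincaré-Birkhoff-Witt theorem. -/
theorem span_eq_top_of_hasSymbol (b : Module.Basis κ K L) {σ : Type*} {α : σ → Multiset κ}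
    {E : σ → UniversalEnvelopingAlgebra K L} (hE : ∀ s, HasSymbol b (α s) (E s))
    (hα : Function.Surjective α) : Submodule.span K (Set.range E) = ⊤ := by
  have h : ∀ k, fil K L k ≤ Submodule.span K (Set.range E) := by
    intro k
    induction k with
    | zero => exact Submodule.span_le.2 fun _ ⟨l, hl, _⟩ => absurd hl (Nat.not_lt_zero _)
    | succ k ih =>
      refine Submodule.span_le.2 ?_
      rintro _ ⟨l, hl, rfl⟩
      refine Submodule.span_le.2 ?_ (list_prod_mem_span_basis b l)
      rintro _ ⟨l', hl', rfl⟩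
      obtain ⟨s, hs⟩ := hα (l' : Multiset κ)
      have h1 := hE s
      rw [hs, hasSymbol_coe] at h1
      -- The basis product differs from `E s` by an error of smaller degree, which the induction
      -- already covers.
      have h2 := ih (fil_mono (by omega : l'.length ≤ k) h1)
      rw [← sub_sub_cancel (E s) (l'.map fun j => ι K (b j)).prod]
      exact sub_mem (Submodule.subset_span ⟨s, rfl⟩) h2
  rw [eq_top_iff]
  intro u _
  obtain ⟨k, hk⟩ := exists_mem_fil u
  exact h k hk

/-- Elements with distinct symbols are linearly independent as soon as ordered monomials can be
separated by linear functionals which vanish in smaller degree. -/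
theorem linearIndependent_of_hasSymbol [DecidableEq κ]
    (hsep : ∀ β : Multiset κ, ∃ φ : UniversalEnvelopingAlgebra K L →ₗ[K] K,
      (∀ u ∈ fil K L (Multiset.card β), φ u = 0) ∧ ∀ l : List κ, l.length = Multiset.card β →
        φ (l.map fun j => ι K (v j)).prod = if (l : Multiset κ) = β then 1 else 0)
    {σ : Type*} {α : σ → Multiset κ} {E : σ → UniversalEnvelopingAlgebra K L}
    (hE : ∀ s, HasSymbol v (α s) (E s)) (hα : Function.Injective α) : LinearIndependent K E := by
  rw [linearIndependent_iff]
  intro c hc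
  by_contra hne
  -- In a nontrivial relation take a term of maximal degree; the functional attached to its symbol
  -- kills every other term.
  obtain ⟨s, hs, hmax⟩ := c.support.exists_max_image (fun s => Multiset.card (α s))
    (Finsupp.support_nonempty_iff.2 hne)
  obtain ⟨φ, hφ0, hφ1⟩ := hsep (α s)
  have hval : ∀ t ∈ c.support, t ≠ s → φ (E t) = 0 := by
    intro t ht hts
    rcases (hmax t ht).lt_or_eq with hlt | heq
    · exact hφ0 _ ((hE t).mem_fil hlt)
    · have h := hE t
      rw [HasSymbol, heq] at h
      have h1 := hφ0 _ h
      rw [map_sub, hφ1 _ (by simpa using heq), Multiset.coe_toList,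
        if_neg (fun h => hts (hα h)), sub_zero] at h1
      exact h1
  have hval' : φ (E s) = 1 := by
    have h1 := hφ0 _ (hE s)
    rw [map_sub, hφ1 _ (by simp), Multiset.coe_toList, if_pos rfl, sub_eq_zero] at h1
    exact h1
  have := congrArg φ hc
  rw [Finsupp.linearCombination_apply, Finsupp.sum, map_sum, Finset.sum_eq_single s] at this
  · rw [map_smul, hval', smul_eq_mul, mul_one, map_zero] at this
    exact Finsupp.mem_support_iff.1 hs this
  · intro t ht hts
    rw [map_smul, hval t ht hts, smul_zero]
  · exact fun h => absurd hs h

end Filtration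

/-! ### Left invariant derivations as tangent vectors at the identity. -/

section PointDerivations

variable {K : Type*} [Field K] {A : Type*} [CommRing A] [HopfAlgebra K A]

variable (K A) in
/-- The pairing `(x, f) ↦ (x f)(1)` of `Lie G` with `K[G]`. -/
noncomputable def counitPairing : lieAlg K A →ₗ[K] A →ₗ[K] K where
  toFun x := Coalgebra.counit ∘ₗ (x.1 : A →ₗ[K] A)
  map_add' x y := by ext; simp
  map_smul' c x := by ext; simp

theorem counitPairing_apply (x : lieAlg K A) (f : A) :
    counitPairing K A x f = Coalgebra.counit (R := K) (x.1 f) := rfl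

/-- By left invariance `x f = (id ⊗ ε∘x)(Δ f)`, so `x` is recovered from its value at the identity.
-/
theorem counitPairing_injective : Function.Injective (counitPairing K A) := by
  rw [← LinearMap.ker_eq_bot, LinearMap.ker_eq_bot']
  intro x hx
  apply Subtype.ext
  ext f
  have h := Coalgebra.lTensor_counit_comul (R := K) (x.1 f)
  rw [comul_lieAlg, ← LinearMap.comp_apply, ← LinearMap.lTensor_comp] at h
  have hx' : Coalgebra.counit ∘ₗ (x.1 : A →ₗ[K] A) = 0 := hx
  rw [hx', LinearMap.lTensor_zero, LinearMap.zero_apply] at h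
  have := congrArg (TensorProduct.rid K A) h
  simpa using this.symm

/-- By the Leibniz rule a tangent vector at the identity is determined by its values on finitely
many algebra generators. -/
theorem finiteDimensional_lieAlg [Algebra.FiniteType K A] : FiniteDimensional K (lieAlg K A) := by
  obtain ⟨s, hs⟩ := (inferInstance : Algebra.FiniteType K A).out
  let f : lieAlg K A →ₗ[K] (s → K) :=
    LinearMap.pi fun a => (LinearMap.applyₗ (a : A)).comp (counitPairing K A)
  refine Module.Finite.of_injective f ?_
  rw [← LinearMap.ker_eq_bot, LinearMap.ker_eq_bot']
  intro x hx
  apply counitPairing_injective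
  rw [map_zero]
  ext a
  have ha : a ∈ Algebra.adjoin K (s : Set A) := hs ▸ Algebra.mem_top
  induction ha using Algebra.adjoin_induction with
  | mem a ha => exact congrFun hx ⟨a, ha⟩
  | algebraMap r => simp [counitPairing_apply]
  | add a b _ _ ha hb => rw [map_add, ha, hb]; simp
  | mul a b _ _ ha hb =>
    simp only [counitPairing_apply, LinearMap.zero_apply] at ha hb ⊢
    simp [ha, hb]

/-- In finite dimension, injectivity of `𝔤 → K[G]*` is surjectivity of `K[G] → 𝔤*`; lift the dual
basis. -/
theorem exists_dual_functions [FiniteDimensional K (lieAlg K A)] {κ : Type*} [DecidableEq κ]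
    (v : Module.Basis κ K (lieAlg K A)) :
    ∃ a : κ → A, ∀ i j, counitPairing K A (v j) (a i) = if i = j then 1 else 0 := by
  have h := LinearMap.flip_surjective_iff₁.2 (counitPairing_injective (K := K) (A := A))
  choose a ha using fun i => h (v.coord i)
  refine ⟨a, fun i j => ?_⟩
  rw [← LinearMap.flip_apply, ha, Module.Basis.coord_apply, Module.Basis.repr_self,
    Finsupp.single_apply]
  simp only [eq_comm]

end PointDerivations

/-! ### Derivations acting on the coefficients of polynomials over `K[G]`. -/

section CoefficientwiseDerivation

variable {K : Type*} [Field K] {A : Type*} [CommRing A] [Algebra K A] {κ : Type*}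

/-- A derivation of `A` applied to the coefficients of a polynomial over `A`. -/
noncomputable def coeffDerivation (D : Derivation K A A) : Module.End K (MvPolynomial κ A) where
  toFun f := .ofCoeff (Finsupp.mapRange D (map_zero D) (AddMonoidAlgebra.coeff f))
  map_add' f g := by
    ext m
    exact map_add D (f.coeff m) (g.coeff m)
  map_smul' c f := by
    ext m
    exact D.map_smul c (f.coeff m)

theorem coeff_coeffDerivation (D : Derivation K A A) (f : MvPolynomial κ A) (m : κ →₀ ℕ) :
    (coeffDerivation D f).coeff m = D (f.coeff m) := rfl

theorem coeffDerivation_mul (D : Derivation K A A) (f g : MvPolynomial κ A) :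
    coeffDerivation D (f * g) = f * coeffDerivation D g + coeffDerivation D f * g := by
  classical
  ext m
  simp only [coeff_coeffDerivation, MvPolynomial.coeff_mul, MvPolynomial.coeff_add, map_sum,
    Derivation.leibniz, smul_eq_mul, Finset.sum_add_distrib]
  congr 1
  exact Finset.sum_congr rfl fun _ _ => mul_comm _ _

variable (κ A) in
/-- Polynomials all of whose monomials have degree less than `k`. -/
def degLT (k : ℕ) : Submodule A (MvPolynomial κ A) where
  carrier := {f | ∀ m, k ≤ m.degree → f.coeff m = 0}
  add_mem' hf hg m hm := by rw [MvPolynomial.coeff_add, hf m hm, hg m hm, add_zero]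
  zero_mem' m _ := MvPolynomial.coeff_zero m
  smul_mem' c f hf m hm := by rw [MvPolynomial.coeff_smul, hf m hm, smul_zero]

theorem degLT_mono {i j : ℕ} (h : i ≤ j) : degLT A κ i ≤ degLT A κ j :=
  fun _ hf m hm => hf m (h.trans hm)

theorem coeffDerivation_mem_degLT (D : Derivation K A A) {k : ℕ} {f : MvPolynomial κ A}
    (hf : f ∈ degLT A κ k) : coeffDerivation D f ∈ degLT A κ k := fun m hm => by
  rw [coeff_coeffDerivation, hf m hm, map_zero]

theorem mul_mem_degLT {k : ℕ} {f g : MvPolynomial κ A} (hf : f ∈ degLT A κ 2)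
    (hg : g ∈ degLT A κ k) : f * g ∈ degLT A κ (k + 1) := fun m hm => by
  classical
  rw [MvPolynomial.coeff_mul]
  refine Finset.sum_eq_zero fun x hx => ?_
  rw [Finset.HasAntidiagonal.mem_antidiagonal] at hx
  rw [← hx, map_add] at hm
  by_cases h : 2 ≤ x.1.degree
  · rw [hf _ h, zero_mul]
  · rw [hg _ (by omega), mul_zero]

end CoefficientwiseDerivation

/-! ### Linear independence in PBW for `Lie G`, by a twisted action on `K[G][T]`. -/

section PBW

attribute [local instance 100] LieRing.ofAssociativeRing

open UniversalEnvelopingAlgebra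

variable {K : Type*} [Field K] {A : Type*} [CommRing A] [HopfAlgebra K A] {κ : Type*} [Fintype κ]

/-- The polynomial `∑ T_i x(a_i)`. -/
noncomputable def symbolPoly (a : κ → A) (x : lieAlg K A) : MvPolynomial κ A :=
  ∑ i, MvPolynomial.C (x.1 (a i)) * MvPolynomial.X i

theorem symbolPoly_mem (a : κ → A) (x : lieAlg K A) : symbolPoly a x ∈ degLT A κ 2 := by
  classical
  refine sum_mem fun i _ m hm => ?_
  rw [MvPolynomial.coeff_C_mul, MvPolynomial.coeff_X, if_neg, mul_zero]
  rintro rfl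
  simp at hm

theorem coeffDerivation_symbolPoly (a : κ → A) (x y : lieAlg K A) :
    coeffDerivation x.1 (symbolPoly a y) =
      ∑ i, MvPolynomial.C (x.1 (y.1 (a i))) * MvPolynomial.X i := by
  classical
  rw [symbolPoly, map_sum]
  refine Finset.sum_congr rfl fun i _ => ?_
  ext m
  rw [coeff_coeffDerivation, MvPolynomial.coeff_C_mul, MvPolynomial.coeff_C_mul,
    MvPolynomial.coeff_X]
  split_ifs <;> simp

/-- The representation of `Lie G` on `K[G][T]` in which `x` acts as the derivation `x` on
coefficients, twisted by the exponential of `∑ T_i a_i`. -/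
noncomputable def twistedRep (a : κ → A) : lieAlg K A →ₗ⁅K⁆ Module.End K (MvPolynomial κ A) where
  toFun x := coeffDerivation x.1 + LinearMap.mulLeft K (symbolPoly a x)
  map_add' x y := by
    refine LinearMap.ext fun f => ?_
    have h : symbolPoly a (x + y) = symbolPoly a x + symbolPoly a y := by
      simp [symbolPoly, add_mul, Finset.sum_add_distrib]
    have h' : coeffDerivation (κ := κ) (x + y).1 = coeffDerivation x.1 + coeffDerivation y.1 := by
      ext f m; rfl
    simp only [h, h', LinearMap.add_apply, LinearMap.mulLeft_apply, add_mul]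
    abel
  map_smul' c x := by
    refine LinearMap.ext fun f => ?_
    have h : symbolPoly a (c • x) = c • symbolPoly a x := by
      rw [symbolPoly, symbolPoly, Finset.smul_sum]
      refine Finset.sum_congr rfl fun i _ => ?_
      change MvPolynomial.C (c • x.1 (a i)) * _ = _
      rw [← smul_mul_assoc, Algebra.smul_def, map_mul, Algebra.smul_def]
      rfl
    have h' : coeffDerivation (κ := κ) (c • x).1 = c • coeffDerivation x.1 := by
      ext f m; rfl
    simp only [h, h', LinearMap.add_apply, LinearMap.mulLeft_apply, LinearMap.smul_apply,
      smul_mul_assoc, smul_add, RingHom.id_apply]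
  map_lie' := by
    intro x y
    rw [LieRing.of_associative_ring_bracket]
    refine LinearMap.ext fun f => ?_
    -- The cocycle identity: this is what makes the twisted operators respect brackets.
    have h : symbolPoly a ⁅x, y⁆ =
        coeffDerivation x.1 (symbolPoly a y) - coeffDerivation y.1 (symbolPoly a x) := by
      rw [coeffDerivation_symbolPoly, coeffDerivation_symbolPoly, ← Finset.sum_sub_distrib]
      refine Finset.sum_congr rfl fun i _ => ?_
      rw [lieAlg_lie_apply, map_sub, sub_mul]
    have h' : coeffDerivation (κ := κ) (⁅x, y⁆ : lieAlg K A).1 f =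
        coeffDerivation x.1 (coeffDerivation y.1 f) -
          coeffDerivation y.1 (coeffDerivation x.1 f) := by
      ext m
      rw [MvPolynomial.coeff_sub]
      simp only [coeff_coeffDerivation]
      exact lieAlg_lie_apply x y _
    simp only [LinearMap.add_apply, LinearMap.mulLeft_apply, LinearMap.sub_apply,
      Module.End.mul_apply, h, h', map_add, coeffDerivation_mul]
    ring

theorem twistedRep_apply (a : κ → A) (x : lieAlg K A) (f : MvPolynomial κ A) :
    twistedRep a x f = coeffDerivation x.1 f + symbolPoly a x * f := rfl

/-- The value at `1` of the action of the enveloping algebra on `K[G][T]`. -/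
noncomputable def orbitMap (a : κ → A) :
    UniversalEnvelopingAlgebra K (lieAlg K A) →ₗ[K] MvPolynomial κ A :=
  (LinearMap.applyₗ (1 : MvPolynomial κ A)).comp (lift K (twistedRep a)).toLinearMap

theorem orbitMap_one (a : κ → A) :
    orbitMap a (1 : UniversalEnvelopingAlgebra K (lieAlg K A)) = 1 := by
  simp [orbitMap]

theorem orbitMap_ι_mul (a : κ → A) (x : lieAlg K A) (u) :
    orbitMap a (ι K x * u) = twistedRep a x (orbitMap a u) := by
  simp only [orbitMap, LinearMap.comp_apply, AlgHom.toLinearMap_apply, map_mul,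
    lift_ι_apply, LinearMap.applyₗ_apply_apply, Module.End.mul_apply]

theorem orbitMap_mem_degLT (a : κ → A) {k : ℕ} {u} (hu : u ∈ fil K (lieAlg K A) k) :
    orbitMap a u ∈ degLT A κ k := by
  have h : ∀ l : List (lieAlg K A), orbitMap a (l.map (ι K)).prod ∈ degLT A κ (l.length + 1) := by
    intro l
    induction l with
    | nil =>
      classical
      rw [List.map_nil, List.prod_nil, orbitMap_one]
      intro m hm
      rw [MvPolynomial.coeff_one, if_neg]
      rintro rfl
      simp at hm
    | cons x l ih =>
      rw [List.map_cons, List.prod_cons, orbitMap_ι_mul, twistedRep_apply]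
      exact add_mem (degLT_mono (by simp) (coeffDerivation_mem_degLT _ ih))
        (mul_mem_degLT (symbolPoly_mem a x) ih)
  have h' : fil K (lieAlg K A) k ≤ ((degLT A κ k).restrictScalars K).comap (orbitMap a) := by
    refine Submodule.span_le.2 ?_
    rintro _ ⟨l, hl, rfl⟩
    exact degLT_mono hl (h l)
  exact h' hu

/-- Differentiating coefficients does not raise the degree in `T`, so the top part comes from the
multiplications alone. -/
theorem orbitMap_prod_sub_mem (a : κ → A) (l : List (lieAlg K A)) :
    orbitMap a (l.map (ι K)).prod - (l.map (symbolPoly a)).prod ∈ degLT A κ l.length := by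
  induction l with
  | nil => simp [orbitMap_one]
  | cons x l ih =>
    rw [List.map_cons, List.prod_cons, orbitMap_ι_mul, twistedRep_apply, List.map_cons,
      List.prod_cons, add_sub_assoc, ← mul_sub]
    exact add_mem (coeffDerivation_mem_degLT _ (orbitMap_mem_degLT a (prod_mem_fil l (by simp))))
      (mul_mem_degLT (symbolPoly_mem a x) ih)

/-- The functional takes the coefficient of `T^β` in `u · 1` and evaluates it at the identity. There
duality turns the symbol of `v_j` into `T_j`, so a product of basis vectors contributes exactly its
own monomial. -/
theorem exists_separating_functional [FiniteDimensional K (lieAlg K A)] [DecidableEq κ]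
    (v : Module.Basis κ K (lieAlg K A)) (β : Multiset κ) :
    ∃ φ : UniversalEnvelopingAlgebra K (lieAlg K A) →ₗ[K] K,
      (∀ u ∈ fil K (lieAlg K A) (Multiset.card β), φ u = 0) ∧ ∀ l : List κ,
        l.length = Multiset.card β →
        φ (l.map fun j => ι K (v j)).prod = if (l : Multiset κ) = β then 1 else 0 := by
  obtain ⟨a, ha⟩ := exists_dual_functions v
  let φ : UniversalEnvelopingAlgebra K (lieAlg K A) →ₗ[K] K :=
    Coalgebra.counit ∘ₗ ((MvPolynomial.lcoeff A (Multiset.toFinsupp β)).restrictScalars K) ∘ₗ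
      orbitMap a
  have hφ : ∀ u, φ u = Coalgebra.counit (R := K)
    ((orbitMap a u).coeff (Multiset.toFinsupp β)) := fun u => rfl
  have hdeg : (Multiset.toFinsupp β).degree = Multiset.card β := by
    rw [← Multiset.toFinsupp_sum_eq]; rfl
  have hmap : ∀ l : List κ, MvPolynomial.map (Bialgebra.counitAlgHom K A : A →+* K)
      (l.map fun j => symbolPoly a (v j)).prod =
        MvPolynomial.monomial (Multiset.toFinsupp (l : Multiset κ)) 1 := by
    have h1 : ∀ j, MvPolynomial.map (Bialgebra.counitAlgHom K A : A →+* K) (symbolPoly a (v j)) =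
        MvPolynomial.X j := by
      intro j
      rw [symbolPoly, map_sum, Finset.sum_eq_single j]
      · have := ha j j
        rw [if_pos rfl, counitPairing_apply] at this
        simp [this]
      · intro i _ hij
        have := ha i j
        rw [if_neg hij, counitPairing_apply] at this
        simp [this]
      · simp
    intro l
    induction l with
    | nil => simp
    | cons j l ih =>
      rw [List.map_cons, List.prod_cons, map_mul, h1, ih, MvPolynomial.X,
        MvPolynomial.monomial_mul, one_mul, ← Multiset.cons_coe, ← Multiset.singleton_add,
        map_add, Multiset.toFinsupp_singleton]
  refine ⟨φ, fun u hu => ?_, fun l hl => ?_⟩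
  · rw [hφ, orbitMap_mem_degLT a hu _ hdeg.ge, map_zero]
  · have h := orbitMap_prod_sub_mem a (l.map v) (Multiset.toFinsupp β) (by simp [hdeg, hl])
    rw [MvPolynomial.coeff_sub, sub_eq_zero, List.map_map, List.map_map] at h
    rw [hφ]
    refine (congrArg (Coalgebra.counit (R := K)) h).trans ?_
    have h2 := congrArg (MvPolynomial.coeff (Multiset.toFinsupp β)) (hmap l)
    rw [MvPolynomial.coeff_map, MvPolynomial.coeff_monomial] at h2
    simp only [EmbeddingLike.apply_eq_iff_eq] at h2
    exact h2

/-- The independence half of the Poincaré-Birkhoff-Witt theorem for `Lie G`: elements of `U(𝔤)`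
with distinct symbols are linearly independent. -/
theorem linearIndependent_of_hasSymbol_lieAlg [FiniteDimensional K (lieAlg K A)]
    (v : Module.Basis κ K (lieAlg K A)) {σ : Type*} {α : σ → Multiset κ}
    {E : σ → UniversalEnvelopingAlgebra K (lieAlg K A)} (hE : ∀ s, HasSymbol v (α s) (E s))
    (hα : Function.Injective α) : LinearIndependent K E := by
  classical
  exact linearIndependent_of_hasSymbol (exists_separating_functional v) hE hα

end PBW

/-! ### Ordered monomials adapted to a character and to the p-centre. -/

section Monomials

attribute [local instance 100] LieRing.ofAssociativeRing

open UniversalEnvelopingAlgebra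

/-- The multiset in which `e j` occurs `c j` times. -/
def exponentMultiset {n : ℕ} {κ : Type*} (e : Fin n → κ) (c : Fin n → ℕ) : Multiset κ :=
  ((List.finRange n).map fun j => c j • ({e j} : Multiset κ)).sum

theorem count_exponentMultiset {n : ℕ} {κ : Type*} [DecidableEq κ] (e : Fin n → κ) (c : Fin n → ℕ)
    (k : κ) : (exponentMultiset e c).count k = ∑ j, if k = e j then c j else 0 := by
  rw [exponentMultiset, ← Fin.sum_univ_def, Multiset.count_sum']
  simp [Multiset.count_singleton]

theorem count_exponentMultiset_self {n : ℕ} {κ : Type*} [DecidableEq κ] {e : Fin n → κ}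
    (he : Function.Injective e) (c : Fin n → ℕ) (i : Fin n) :
    (exponentMultiset e c).count (e i) = c i := by
  simp [count_exponentMultiset, he.eq_iff]

theorem count_exponentMultiset_of_ne {n : ℕ} {κ : Type*} [DecidableEq κ] {e : Fin n → κ} {k : κ}
    (hk : ∀ i, k ≠ e i) (c : Fin n → ℕ) : (exponentMultiset e c).count k = 0 := by
  simp [count_exponentMultiset, hk]

theorem exponentMultiset_id_surjective {n : ℕ} :
    Function.Surjective (exponentMultiset (id : Fin n → Fin n)) := fun β => by
  classical
  refine ⟨fun i => β.count i, ?_⟩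
  ext i
  exact count_exponentMultiset_self Function.injective_id _ i

/-- Injectivity gives independence and surjectivity gives spanning for the adapted PBW basis. -/
theorem exponentMultiset_sum_bijective {r s : ℕ} : Function.Bijective
    fun q : (Fin r → ℕ) × (Fin s → ℕ) =>
      exponentMultiset (Sum.inl : _ → Fin r ⊕ Fin s) q.1 + exponentMultiset Sum.inr q.2 := by
  classical
  have hl : ∀ (q : (Fin r → ℕ) × (Fin s → ℕ)) i,
      (exponentMultiset (Sum.inl : _ → Fin r ⊕ Fin s) q.1 + exponentMultiset Sum.inr q.2).count
        (Sum.inl i) = q.1 i := fun q i => by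
    rw [Multiset.count_add, count_exponentMultiset_self Sum.inl_injective,
      count_exponentMultiset_of_ne (by simp), add_zero]
  have hr : ∀ (q : (Fin r → ℕ) × (Fin s → ℕ)) i,
      (exponentMultiset (Sum.inl : _ → Fin r ⊕ Fin s) q.1 + exponentMultiset Sum.inr q.2).count
        (Sum.inr i) = q.2 i := fun q i => by
    rw [Multiset.count_add, count_exponentMultiset_self Sum.inr_injective,
      count_exponentMultiset_of_ne (by simp), zero_add]
  constructor
  · intro q q' h
    refine Prod.ext (funext fun i => ?_) (funext fun i => ?_)
    · rw [← hl q, ← hl q']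
      exact congrArg _ h
    · rw [← hr q, ← hr q']
      exact congrArg _ h
  · intro β
    refine ⟨(fun i => β.count (Sum.inl i), fun i => β.count (Sum.inr i)), ?_⟩
    ext k
    rcases k with i | i
    · exact hl _ i
    · exact hr _ i

section Shifted

variable {K : Type*} [Field K] {L : Type*} [LieRing L] [LieAlgebra K L]

/-- The ordered monomial in the shifted elements `x_i - χ(x_i)` with exponents `b`. -/
noncomputable def shiftedMonomial {s : ℕ} (x : Fin s → L) (χ : L → K) (b : Fin s → ℕ) :
    UniversalEnvelopingAlgebra K L :=
  ((List.finRange s).map fun i => (ι K (x i) - algebraMap K _ (χ (x i))) ^ b i).prod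

theorem hasSymbol_shiftedMonomial {s : ℕ} {κ : Type*} {v : κ → L} {x : Fin s → L} (e : Fin s → κ)
    (he : ∀ i, v (e i) = x i) (χ : L → K) (b : Fin s → ℕ) :
    HasSymbol v (exponentMultiset e b) (shiftedMonomial x χ b) := by
  refine hasSymbol_list_prod (α := fun i => b i • ({e i} : Multiset κ))
    (fun i => HasSymbol.pow ?_ (b i)) (List.finRange s)
  rw [← he]
  refine (hasSymbol_ι _).sub_lower ?_
  rw [Algebra.algebraMap_eq_smul_one]
  exact Submodule.smul_mem _ _ (one_mem_fil (by simp))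

theorem span_shiftedMonomial {s : ℕ} (x : Module.Basis (Fin s) K L) (χ : L → K) :
    Submodule.span K (Set.range (shiftedMonomial x χ)) = ⊤ :=
  span_eq_top_of_hasSymbol x (hasSymbol_shiftedMonomial id (fun _ => rfl) χ)
    exponentMultiset_id_surjective

/-- The character kills every `x_i - χ(x_i)`, and `0 ^ 0 = 1` leaves only the empty monomial. -/
theorem lift_shiftedMonomial {s : ℕ} (x : Fin s → L) (χ : L →ₗ⁅K⁆ K) (b : Fin s → ℕ) :
    lift K χ (shiftedMonomial x χ b) = if b = 0 then 1 else 0 := by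
  rw [shiftedMonomial, map_list_prod, List.map_map]
  have : (⇑(lift K χ) ∘ fun i => (ι K (x i) - algebraMap K _ (χ (x i))) ^ b i) =
      fun i => (0 : K) ^ b i := by
    ext i
    simp only [Function.comp_apply, map_pow, map_sub, lift_ι_apply, AlgHom.commutes]
    simp
  rw [this, ← Fin.prod_univ_def]
  split_ifs with h
  · simp [h]
  · obtain ⟨i, hi⟩ := Function.ne_iff.1 h
    exact Finset.prod_eq_zero (Finset.mem_univ i) (zero_pow hi)

end Shifted

variable (p : ℕ) [Fact p.Prime] {K : Type*} [Field K] [CharP K p]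
  {A : Type*} [CommRing A] [HopfAlgebra K A]

/-- The product of the `ξ(y_j)^q_j y_j^a_j` where `c_j = p q_j + a_j` with `0 ≤ a_j < p`. -/
noncomputable def pMonomial {r : ℕ} (y : Fin r → lieAlg K A) (c : Fin r → ℕ) :
    UniversalEnvelopingAlgebra K (lieAlg K A) :=
  ((List.finRange r).map fun j => xi p (y j) ^ (c j / p) * ι K (y j) ^ (c j % p)).prod

/-- `ξ(y) = y^p - y^[p]` has the symbol of `y^p` because `p ≥ 2`; thus `ξ(y)^q y^a` has that of
`y^(pq+a)`. -/
theorem hasSymbol_pMonomial {r : ℕ} {κ : Type*} {v : κ → lieAlg K A} {y : Fin r → lieAlg K A}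
    (e : Fin r → κ) (he : ∀ j, v (e j) = y j) (c : Fin r → ℕ) :
    HasSymbol v (exponentMultiset e c) (pMonomial p y c) := by
  refine hasSymbol_list_prod (α := fun i => c i • ({e i} : Multiset κ))
    (fun j => ?_) (List.finRange r)
  have h1 : HasSymbol v (p • ({e j} : Multiset κ)) (xi p (y j)) := by
    rw [← he]
    exact ((hasSymbol_ι _).pow p).sub_lower
      (ι_mem_fil _ (by simpa using (Fact.out : p.Prime).two_le))
  have h2 : HasSymbol v {e j} (ι K (y j)) := he j ▸ hasSymbol_ι _
  have h3 := (h1.pow (c j / p)).mul (h2.pow (c j % p))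
  rwa [smul_smul, ← add_smul, Nat.div_add_mod' (c j) p] at h3

/-- The `ξ(y_j)` commute with all of `𝔤`, so they can be collected on the left. -/
theorem pMonomial_eq_mul {r : ℕ} (y : Fin r → lieAlg K A) (q : Fin r → ℕ) (a : Fin r → Fin p) :
    pMonomial p y (fun j => p * q j + a j) =
      ((List.finRange r).map fun j => xi p (y j) ^ q j).prod *
        ((List.finRange r).map fun j => ι K (y j) ^ (a j : ℕ)).prod := by
  have hp := (Fact.out : p.Prime).pos
  have h : ∀ j, (p * q j + a j) / p = q j ∧ (p * q j + a j) % p = a j := fun j =>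
    ⟨by rw [Nat.mul_add_div hp, Nat.div_eq_of_lt (a j).2, add_zero],
      by rw [Nat.mul_add_mod, Nat.mod_eq_of_lt (a j).2]⟩
  simp only [pMonomial, h]
  induction List.finRange r with
  | nil => simp
  | cons j l ih =>
    have hc : Commute (ι K (y j) ^ (a j : ℕ)) (l.map fun j => xi p (y j) ^ q j).prod := by
      refine Commute.list_prod_right _ _ fun z hz => ?_
      obtain ⟨k, -, rfl⟩ := List.mem_map.1 hz
      exact ((xi_commute_ι p (y k) (y j)).symm.pow_left _).pow_right _
    simp only [List.map_cons, List.prod_cons, ih]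
    rw [mul_assoc, mul_assoc, ← mul_assoc (ι K (y j) ^ _), hc.eq, mul_assoc]

end Monomials

/-! ### Modules induced from a character. -/

section InducedCharacter

variable {K : Type*} [Field K] {B C : Type*} [Ring B] [Algebra K B] [Ring C] [Algebra K C]

/-- The identification of `K_φ` with `K`. -/
noncomputable def charEquiv (φ : B →ₐ[K] K) : CharModule φ ≃ₗ[K] K := LinearEquiv.refl K K

theorem charEquiv_smul (φ : B →ₐ[K] K) (b : B) (k : CharModule φ) :
    charEquiv φ (b • k) = φ b * charEquiv φ k := rfl

/-- The generator `1 ⊗ 1` of a module induced from a character. -/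
noncomputable def inducedGen (f : B →ₐ[K] C) (φ : B →ₐ[K] K) : InducedModule f (CharModule φ) :=
  Submodule.Quotient.mk ((1 : C) ⊗ₜ[K] (charEquiv φ).symm 1)

theorem smul_inducedGen (f : B →ₐ[K] C) (φ : B →ₐ[K] K) (c : C) :
    c • inducedGen f φ = Submodule.Quotient.mk (c ⊗ₜ[K] (charEquiv φ).symm 1) := by
  rw [inducedGen, ← Submodule.Quotient.mk_smul, TensorProduct.smul_tmul', smul_eq_mul, mul_one]

theorem exists_smul_inducedGen (f : B →ₐ[K] C) (φ : B →ₐ[K] K)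
    (q : InducedModule f (CharModule φ)) : ∃ c : C, c • inducedGen f φ = q := by
  obtain ⟨t, rfl⟩ := Submodule.Quotient.mk_surjective _ q
  induction t with
  | zero => exact ⟨0, by rw [zero_smul, Submodule.Quotient.mk_zero]⟩
  | tmul a k =>
    refine ⟨charEquiv φ k • a, ?_⟩
    rw [smul_inducedGen, TensorProduct.smul_tmul, ← map_smul, smul_eq_mul, mul_one,
      LinearEquiv.symm_apply_apply]
  | add a b ha hb =>
    obtain ⟨u, hu⟩ := ha
    obtain ⟨w, hw⟩ := hb
    exact ⟨u + w, by rw [add_smul, hu, hw, Submodule.Quotient.mk_add]⟩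

theorem map_smul_inducedGen (f : B →ₐ[K] C) (φ : B →ₐ[K] K) (b : B) :
    f b • inducedGen f φ = φ b • inducedGen f φ := by
  have h : φ b • inducedGen f φ =
      Submodule.Quotient.mk ((1 : C) ⊗ₜ[K] (b • (charEquiv φ).symm 1)) := by
    rw [inducedGen, ← Submodule.Quotient.mk_smul, ← TensorProduct.tmul_smul]
    rfl
  rw [h, smul_inducedGen, ← sub_eq_zero, ← Submodule.Quotient.mk_sub,
    Submodule.Quotient.mk_eq_zero]
  exact Submodule.subset_span ⟨1, b, _, by rw [one_mul]⟩

theorem mul_map_smul_inducedGen (f : B →ₐ[K] C) (φ : B →ₐ[K] K) (c : C) (b : B) :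
    (c * f b) • inducedGen f φ = φ b • c • inducedGen f φ := by
  rw [mul_smul, map_smul_inducedGen, smul_algebra_smul_comm]

/-- A functional on `C` that is equivariant for the right action of `B` through `φ` descends to the
induced module, so it detects nonzero multiples of the generator. -/
theorem apply_eq_zero_of_smul_inducedGen {f : B →ₐ[K] C} {φ : B →ₐ[K] K} {g : C →ₗ[K] K}
    (hg : ∀ c b, g (c * f b) = g c * φ b) {c : C} (hc : c • inducedGen f φ = 0) : g c = 0 := by
  let F : C ⊗[K] CharModule φ →ₗ[K] K :=
    TensorProduct.lift ((LinearMap.mul K K).compl₂ (charEquiv φ).toLinearMap ∘ₗ g)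
  have hF : ∀ u k, F (u ⊗ₜ k) = g u * charEquiv φ k := fun u k => rfl
  -- The relations span a `C`-submodule while `F` is only `K`-linear; quantifying over all multiples
  -- `u • z` lets the span induction pass through `C`-scalars.
  have hle : ∀ z ∈ balancedRelations f (CharModule φ), ∀ u : C, F (u • z) = 0 := by
    intro z hz
    induction hz using Submodule.span_induction with
    | mem z hz =>
      obtain ⟨a, b, k, rfl⟩ := hz
      intro u
      rw [smul_sub, TensorProduct.smul_tmul', TensorProduct.smul_tmul', map_sub, hF, hF,
        smul_eq_mul, smul_eq_mul, ← mul_assoc, hg, charEquiv_smul]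
      ring
    | zero => simp
    | add a b _ _ ha hb => intro u; rw [smul_add, map_add, ha, hb, add_zero]
    | smul a z _ hz => intro u; rw [smul_smul]; exact hz _
  rw [smul_inducedGen, Submodule.Quotient.mk_eq_zero] at hc
  have h := hle _ hc 1
  rwa [one_smul, hF, LinearEquiv.apply_symm_apply, mul_one] at h

end InducedCharacter

/-! ### Adapted bases and the generator of `Q_χ`. -/

section GelfandGraevModule

attribute [local instance 100] LieRing.ofAssociativeRing

open UniversalEnvelopingAlgebra

variable {p : ℕ} [Fact p.Prime] {K : Type*} [Field K] [CharP K p]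
  {A : Type*} [CommRing A] [HopfAlgebra K A]

namespace GelfandGraevData

variable (d : GelfandGraevData p K A)

theorem inclU_ι (x : d.m) : d.inclU (ι K x) = ι K (x : lieAlg K A) := by
  rw [inclU, lift_ι_apply]; rfl

theorem inclU_shiftedMonomial {s : ℕ} (x : Fin s → d.m) (χ : Module.Dual K (lieAlg K A))
    (b : Fin s → ℕ) :
    d.inclU (shiftedMonomial x (fun z => χ z) b) = shiftedMonomial (fun i => (x i).1) χ b := by
  rw [shiftedMonomial, map_list_prod, List.map_map, shiftedMonomial]
  congr 2
  ext i
  simp only [Function.comp_apply, map_pow, map_sub, inclU_ι, AlgHom.commutes]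

/-- A basis of `𝔤` which extends a basis of `𝔪`. -/
structure AdaptedBasis where
  /-- the codimension of `𝔪` -/
  r : ℕ
  /-- the dimension of `𝔪` -/
  s : ℕ
  /-- the basis of `𝔪` -/
  x : Module.Basis (Fin s) K d.m
  /-- the basis of `𝔤` -/
  v : Module.Basis (Fin r ⊕ Fin s) K (lieAlg K A)
  v_inr : ∀ i, v (Sum.inr i) = x i

theorem nonempty_adaptedBasis [FiniteDimensional K (lieAlg K A)] : Nonempty d.AdaptedBasis := by
  obtain ⟨C, hC⟩ := d.m.toSubmodule.exists_isCompl
  let x := Module.finBasis K d.m.toSubmodule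
  let y := Module.finBasis K C
  exact ⟨⟨_, _, x, (y.prod x).map (Submodule.prodEquivOfIsCompl C d.m.toSubmodule hC.symm),
    fun i => by simp [x]⟩⟩

/-- The image of `1 ⊗ 1` in `Q_χ`. -/
noncomputable def genQ [Infinite K] : d.Q := inducedGen d.inclU d.chiU

end GelfandGraevData

end GelfandGraevModule

/-! ### The adapted PBW basis of `U(𝔤)` and freeness of `Q_χ` over the polynomials in the `ξ(y_j)`.
-/

section GelfandGraevModuleBasis

attribute [local instance 100] LieRing.ofAssociativeRing

open UniversalEnvelopingAlgebra

variable {p : ℕ} [Fact p.Prime] {K : Type*} [Field K] [CharP K p]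
  {A : Type*} [CommRing A] [HopfAlgebra K A]

namespace GelfandGraevData

variable {d : GelfandGraevData p K A}

namespace AdaptedBasis

variable (B : d.AdaptedBasis)

/-- The basis vectors outside `𝔪`. -/
noncomputable def y (j : Fin B.r) : lieAlg K A := B.v (Sum.inl j)

/-- The basis of `U(𝔤)` adapted to the p-centre and to the left ideal generated by the
`x - χ(x)`, `x ∈ 𝔪`. -/
noncomputable def pbwElement (q : (Fin B.r → ℕ) × (Fin B.s → ℕ)) :
    UniversalEnvelopingAlgebra K (lieAlg K A) :=
  pMonomial p B.y q.1 * shiftedMonomial (fun i => (B.x i).1) d.chi q.2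

theorem hasSymbol_pbwElement (q : (Fin B.r → ℕ) × (Fin B.s → ℕ)) :
    HasSymbol B.v (exponentMultiset Sum.inl q.1 + exponentMultiset Sum.inr q.2) (B.pbwElement q) :=
  (hasSymbol_pMonomial p _ (fun _ => rfl) _).mul
    (hasSymbol_shiftedMonomial _ (fun i => B.v_inr i) _ _)

/-- The polynomials in the `ξ(y_j)`. -/
noncomputable def theta : MvPolynomial (Fin B.r) K →ₐ[K] pCentre p K A :=
  MvPolynomial.aeval fun j => xiZ p (B.y j)

theorem theta_monomial (q : Fin B.r →₀ ℕ) (c : K) :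
    ((B.theta (MvPolynomial.monomial q c) : pCentre p K A) :
      UniversalEnvelopingAlgebra K (lieAlg K A)) =
        c • ((List.finRange B.r).map fun j => xi p (B.y j) ^ q j).prod := by
  rw [theta, MvPolynomial.aeval_monomial, Finsupp.prod_fintype _ _ (fun _ => pow_zero _),
    Fin.prod_univ_def, ← Algebra.smul_def]
  change (pCentre p K A).val (c • _) = _
  rw [map_smul, map_list_prod, List.map_map]
  rfl

/-- The ordered monomial in the `y_j` with exponents less than `p`. -/
noncomputable def restrictedMonomial (a : Fin B.r → Fin p) :
    UniversalEnvelopingAlgebra K (lieAlg K A) :=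
  ((List.finRange B.r).map fun j => ι K (B.y j) ^ (a j : ℕ)).prod

theorem theta_monomial_mul (q : Fin B.r →₀ ℕ) (c : K) (a : Fin B.r → Fin p) :
    ((B.theta (MvPolynomial.monomial q c) : pCentre p K A) :
      UniversalEnvelopingAlgebra K (lieAlg K A)) * B.restrictedMonomial a =
        c • pMonomial p B.y fun j => p * q j + a j := by
  rw [theta_monomial, restrictedMonomial, pMonomial_eq_mul, smul_mul_assoc]

variable [FiniteDimensional K (lieAlg K A)]

/-- The `pbwElement`s as a basis of `U(𝔤)`. -/
noncomputable def basisU : Module.Basis ((Fin B.r → ℕ) × (Fin B.s → ℕ)) K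
    (UniversalEnvelopingAlgebra K (lieAlg K A)) :=
  Module.Basis.mk
    (linearIndependent_of_hasSymbol_lieAlg B.v B.hasSymbol_pbwElement
      exponentMultiset_sum_bijective.1)
    (span_eq_top_of_hasSymbol B.v B.hasSymbol_pbwElement exponentMultiset_sum_bijective.2).ge

theorem basisU_apply (q : (Fin B.r → ℕ) × (Fin B.s → ℕ)) : B.basisU q = B.pbwElement q :=
  Module.Basis.mk_apply _ _ _

/-- The coordinate of `u ∈ U(𝔤)` at the monomial `pMonomial c`. -/
noncomputable def coord (c : Fin B.r → ℕ) : UniversalEnvelopingAlgebra K (lieAlg K A) →ₗ[K] K :=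
  B.basisU.coord (c, 0)

theorem coord_pbwElement (c c' : Fin B.r → ℕ) (b : Fin B.s → ℕ) :
    B.coord c (B.pbwElement (c', b)) = if c' = c ∧ b = 0 then 1 else 0 := by
  classical
  rw [← basisU_apply, coord, Module.Basis.coord_apply, Module.Basis.repr_self,
    Finsupp.single_apply]
  simp only [Prod.mk.injEq]

theorem coord_pMonomial (c c' : Fin B.r → ℕ) :
    B.coord c (pMonomial p B.y c') = if c' = c then 1 else 0 := by
  have h := B.coord_pbwElement c c' 0
  have h1 : shiftedMonomial (fun i => (B.x i).1) d.chi 0 = 1 := by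
    simp [shiftedMonomial]
  rw [pbwElement, h1, mul_one] at h
  simpa using h

/-- Division with remainder by `p` splits each exponent uniquely as `p q_j + a_j`, so one coordinate
reads off one coefficient of one polynomial. -/
theorem coord_theta_mul (q : Fin B.r →₀ ℕ) (a a' : Fin B.r → Fin p)
    (f : MvPolynomial (Fin B.r) K) :
    B.coord (fun j => p * q j + a j) ((B.theta f : pCentre p K A) * B.restrictedMonomial a') =
      if a' = a then f.coeff q else 0 := by
  classical
  have hp := (Fact.out : p.Prime).pos
  induction f using MvPolynomial.induction_on' with
  | monomial q' c =>
    rw [theta_monomial_mul, map_smul, coord_pMonomial, MvPolynomial.coeff_monomial, smul_eq_mul]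
    have h : ((fun j => p * q' j + (a' j : ℕ)) = fun j => p * q j + (a j : ℕ)) ↔
        a' = a ∧ q' = q := by
      constructor
      · intro h
        constructor
        · ext j
          have := congrArg (· % p) (congrFun h j)
          simpa [Nat.mul_add_mod, Nat.mod_eq_of_lt (a j).2, Nat.mod_eq_of_lt (a' j).2] using this
        · ext j
          have := congrArg (· / p) (congrFun h j)
          simpa [Nat.mul_add_div hp, Nat.div_eq_of_lt (a j).2, Nat.div_eq_of_lt (a' j).2] using this
      · rintro ⟨rfl, rfl⟩
        rfl
    simp only [h]
    by_cases h1 : a' = a <;> by_cases h2 : q' = q <;> simp [h1, h2]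
  | add f g hf hg =>
    rw [map_add]
    change B.coord _ (((B.theta f : UniversalEnvelopingAlgebra K (lieAlg K A)) + B.theta g) * _) = _
    rw [add_mul, map_add, hf, hg, MvPolynomial.coeff_add]
    split_ifs <;> simp

variable [Infinite K]

/-- Shifted monomials span `U(𝔪)`, and on them both the coordinate and `χ` detect only the empty
monomial. -/
theorem coord_pMonomial_mul (c c' : Fin B.r → ℕ) (w : UniversalEnvelopingAlgebra K d.m) :
    B.coord c (pMonomial p B.y c' * d.inclU w) = if c' = c then d.chiU w else 0 := by
  have h : (B.coord c).comp ((LinearMap.mulLeft K (pMonomial p B.y c')).comp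
      d.inclU.toLinearMap) = if c' = c then d.chiU.toLinearMap else 0 := by
    refine LinearMap.ext_on_range (span_shiftedMonomial B.x d.chiM) fun b => ?_
    have h1 := d.inclU_shiftedMonomial B.x d.chi b
    have h2 := lift_shiftedMonomial B.x d.chiM b
    have h3 := B.coord_pbwElement c c' b
    rw [pbwElement, ← h1] at h3
    refine h3.trans ?_
    by_cases hc : c' = c
    · simp only [hc, if_true, true_and]
      exact h2.symm
    · simp [hc]
  have := LinearMap.congr_fun h w
  rw [apply_ite (fun f : UniversalEnvelopingAlgebra K d.m →ₗ[K] K => f w)] at this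
  exact this

/-- This is the equivariance that lets the coordinate descend to `Q_χ`. On a basis element the
factor from `U(𝔪)` is absorbed into the shifted monomial, and `χ` is multiplicative. -/
theorem coord_mul_inclU (c : Fin B.r → ℕ) (u : UniversalEnvelopingAlgebra K (lieAlg K A))
    (w : UniversalEnvelopingAlgebra K d.m) :
    B.coord c (u * d.inclU w) = B.coord c u * d.chiU w := by
  have h : (B.coord c).comp (LinearMap.mulRight K (d.inclU w)) = d.chiU w • B.coord c := by
    refine B.basisU.ext fun q => ?_
    obtain ⟨c', b⟩ := q
    rw [basisU_apply, pbwElement, ← d.inclU_shiftedMonomial B.x d.chi b]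
    simp only [LinearMap.comp_apply, LinearMap.mulRight_apply, LinearMap.smul_apply, smul_eq_mul]
    rw [mul_assoc, ← map_mul, coord_pMonomial_mul, coord_pMonomial_mul, map_mul]
    split_ifs
    · rw [mul_comm]
    · rw [mul_zero]
  have := LinearMap.congr_fun h u
  rw [mul_comm]
  exact this

theorem coord_eq_zero_of_smul_genQ {u : UniversalEnvelopingAlgebra K (lieAlg K A)}
    (hu : u • d.genQ = 0) (c : Fin B.r → ℕ) : B.coord c u = 0 :=
  apply_eq_zero_of_smul_inducedGen (B.coord_mul_inclU c) hu

end AdaptedBasis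

variable (d) [Infinite K]

theorem exists_smul_genQ (q : d.Q) :
    ∃ u : UniversalEnvelopingAlgebra K (lieAlg K A), u • d.genQ = q :=
  exists_smul_inducedGen d.inclU d.chiU q

theorem inclU_smul_genQ (w : UniversalEnvelopingAlgebra K d.m) :
    d.inclU w • d.genQ = d.chiU w • d.genQ :=
  map_smul_inducedGen d.inclU d.chiU w

/-- As `ξ(x)` is central, it suffices to act on the generator. There it acts as an element of
`U(𝔪)`, because `x^[p] ∈ 𝔪`, and the term `χ(x^[p])` vanishes. -/
theorem xiZ_smul_Q {x : lieAlg K A} (hx : x ∈ d.m) (q : d.Q) :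
    xiZ p x • q = d.chi x ^ p • q := by
  obtain ⟨u, rfl⟩ := d.exists_smul_genQ q
  obtain ⟨h1, h2⟩ := d.pMap_mem_m hx
  have hc : xi p x * u = u * xi p x := by
    induction u using ue_induction with
    | halg r => exact (Algebra.commutes r _).symm
    | hι y => exact xi_commute_ι p x y
    | hadd a b ha hb => rw [mul_add, add_mul, ha, hb]
    | hmul a b ha hb => rw [← mul_assoc, ha, mul_assoc, hb, mul_assoc]
  have hxi : xi p x = d.inclU (ι K ⟨x, hx⟩ ^ p - ι K ⟨pMap p x, h1⟩) := by
    rw [map_sub, map_pow, inclU_ι, inclU_ι]; rfl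
  have hchi : d.chiU (ι K ⟨x, hx⟩ ^ p - ι K ⟨pMap p x, h1⟩) = d.chi x ^ p := by
    have h3 : ∀ z : d.m, d.chiU (ι K z) = d.chi z := fun z => by rw [chiU, lift_ι_apply]; rfl
    rw [map_sub, map_pow, h3, h3, h2, sub_zero]
  change xi p x • u • d.genQ = _
  rw [smul_smul, hc, ← smul_smul, hxi, inclU_smul_genQ, hchi, smul_comm]

namespace AdaptedBasis

variable {d} (B : d.AdaptedBasis)

/-- The map `(f_a) ↦ ∑ f_a(ξ(y)) y^a ⊗ 1`. -/
noncomputable def expansion : ((Fin B.r → Fin p) → MvPolynomial (Fin B.r) K) →ₗ[K] d.Q where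
  toFun f := ∑ a, B.theta (f a) • B.restrictedMonomial a • d.genQ
  map_add' f g := by
    simp only [Pi.add_apply, map_add, add_smul, Finset.sum_add_distrib]
  map_smul' c f := by
    simp only [Pi.smul_apply, map_smul, smul_assoc, Finset.smul_sum, RingHom.id_apply]

theorem expansion_apply (f : (Fin B.r → Fin p) → MvPolynomial (Fin B.r) K) :
    B.expansion f = ∑ a, B.theta (f a) • B.restrictedMonomial a • d.genQ := rfl

theorem expansion_single (a : Fin B.r → Fin p) (f : MvPolynomial (Fin B.r) K) :
    B.expansion (Pi.single a f) = B.theta f • B.restrictedMonomial a • d.genQ := by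
  rw [expansion_apply, Finset.sum_eq_single a]
  · rw [Pi.single_eq_same]
  · intro b _ hb
    rw [Pi.single_eq_of_ne hb, map_zero, zero_smul]
  · simp

variable [FiniteDimensional K (lieAlg K A)]

/-- The descended coordinates recover every coefficient of every `f_a`. -/
theorem expansion_injective : Function.Injective B.expansion := by
  rw [← LinearMap.ker_eq_bot, LinearMap.ker_eq_bot']
  intro f hf
  have h : (∑ a, ((B.theta (f a) : pCentre p K A) : UniversalEnvelopingAlgebra K (lieAlg K A)) *
      B.restrictedMonomial a) • d.genQ = 0 := by
    rw [Finset.sum_smul, ← hf, expansion_apply]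
    exact Finset.sum_congr rfl fun a _ => mul_smul _ _ _
  ext a q
  have h2 := B.coord_eq_zero_of_smul_genQ h (fun j => p * q j + a j)
  rw [map_sum] at h2
  simpa [coord_theta_mul] using h2

/-- On the generator the shifted part of a basis element acts by a scalar; quotients and remainders
of the other exponents by `p` give the polynomial and the restricted monomial. -/
theorem expansion_surjective : Function.Surjective B.expansion := by
  have hp := (Fact.out : p.Prime).pos
  intro q
  obtain ⟨u, rfl⟩ := d.exists_smul_genQ q
  have hmem : ∀ c, pMonomial p B.y c • d.genQ ∈ LinearMap.range B.expansion := by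
    intro c
    refine ⟨Pi.single (fun j => ⟨c j % p, Nat.mod_lt _ hp⟩)
      (MvPolynomial.monomial (Finsupp.equivFunOnFinite.symm fun j => c j / p) 1), ?_⟩
    rw [expansion_single]
    have h := B.theta_monomial_mul (Finsupp.equivFunOnFinite.symm fun j => c j / p) 1
      (fun j => ⟨c j % p, Nat.mod_lt _ hp⟩)
    simp only [one_smul, Finsupp.coe_equivFunOnFinite_symm, Nat.div_add_mod] at h
    rw [← h]
    exact (mul_smul ((B.theta _ : pCentre p K A) : UniversalEnvelopingAlgebra K (lieAlg K A)) _
      d.genQ).symm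
  have hbasis : ∀ c b, B.basisU (c, b) • d.genQ ∈ LinearMap.range B.expansion := by
    intro c b
    have h : B.basisU (c, b) • d.genQ =
        d.chiU (shiftedMonomial B.x (fun z => d.chi z) b) • pMonomial p B.y c • d.genQ := by
      rw [basisU_apply, pbwElement, ← d.inclU_shiftedMonomial B.x d.chi b]
      exact mul_map_smul_inducedGen d.inclU d.chiU _ _
    rw [h]
    exact Submodule.smul_mem _ _ (hmem c)
  let F : UniversalEnvelopingAlgebra K (lieAlg K A) →ₗ[K] d.Q :=
    (LinearMap.toSpanSingleton (UniversalEnvelopingAlgebra K (lieAlg K A)) d.Q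
      d.genQ).restrictScalars K
  have hle : Submodule.span K (Set.range B.basisU) ≤ (LinearMap.range B.expansion).comap F := by
    refine Submodule.span_le.2 ?_
    rintro _ ⟨⟨c, b⟩, rfl⟩
    exact hbasis c b
  exact hle (B.basisU.mem_span u)

end AdaptedBasis

end GelfandGraevData

end GelfandGraevModuleBasis

/-- Independence over the quotient is tested on lifts to `R`, where a relation need only force its
coefficients into `I`. -/
theorem nonempty_basis_quotient {R M ι : Type*} [CommRing R] [AddCommGroup M] [Module R M]
    [Fintype ι] {I : Ideal R} (h : Module.IsTorsionBySet R M I) (w : ι → M)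
    (hli : ∀ g : ι → R, ∑ i, g i • w i = 0 → ∀ i, g i ∈ I)
    (hspan : ∀ q : M, ∃ g : ι → R, ∑ i, g i • w i = q) :
    letI : Module (R ⧸ I) M := h.module
    Nonempty (Module.Basis ι (R ⧸ I) M) := by
  let _ : Module (R ⧸ I) M := h.module
  have hmk : ∀ (z : R) (q : M), Ideal.Quotient.mk I z • q = z • q := fun z q => h.mk_smul z q
  have hw : LinearIndependent (R ⧸ I) w := by
    rw [Fintype.linearIndependent_iff]
    intro g hg i
    choose f hf using fun i => Ideal.Quotient.mk_surjective (g i)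
    rw [← hf]
    refine Ideal.Quotient.eq_zero_iff_mem.2 (hli f ?_ i)
    rw [← hg]
    exact Finset.sum_congr rfl fun i _ => by rw [← hf, hmk]
  refine ⟨Module.Basis.mk hw ?_⟩
  rintro q -
  obtain ⟨g, rfl⟩ := hspan q
  refine sum_mem fun i _ => ?_
  rw [← hmk]
  exact Submodule.smul_mem _ _ (Submodule.subset_span ⟨i, rfl⟩)

/-! ### Comparison of `mIdeal`, the annihilator of `Q_χ` and `I(𝔪)`. -/

section Annihilator

variable {p : ℕ} [Fact p.Prime] {K : Type*} [Field K] [CharP K p]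
  {A : Type*} [CommRing A] [HopfAlgebra K A]

namespace GelfandGraevData

variable (d : GelfandGraevData p K A)

/-- The ideal of `Z_0(𝔤)` generated by the `ξ(x) - χ(x)^p` with `x ∈ 𝔪`. -/
noncomputable def mIdeal : Ideal (pCentre p K A) :=
  Ideal.span {z | ∃ x ∈ d.m, xiZ p x - algebraMap K (pCentre p K A) (d.chi x ^ p) = z}

/-- Each `η ∈ χ + 𝔪^⊥` agrees with `χ` on `𝔪`, so the generators of `mIdeal` are among those of
`I_η`. -/
theorem mIdeal_le_I : d.mIdeal ≤ d.I := by
  refine Ideal.span_le.2 ?_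
  rintro _ ⟨x, hx, rfl⟩
  simp only [I, vanishingIdeal, SetLike.mem_coe, Ideal.mem_iInf]
  rintro η ⟨ψ, hψ, rfl⟩
  have h : ψ x = 0 := (Submodule.mem_dualAnnihilator ψ).1 hψ x hx
  have : (d.chi + ψ) x = d.chi x := by rw [LinearMap.add_apply, h, add_zero]
  rw [← this]
  exact Ideal.subset_span ⟨x, rfl⟩

theorem mIdeal_le_annihilator [Infinite K] :
    d.mIdeal ≤ Module.annihilator (pCentre p K A) d.Q := by
  refine Ideal.span_le.2 ?_
  rintro _ ⟨x, hx, rfl⟩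
  simp only [SetLike.mem_coe, Module.mem_annihilator]
  intro q
  rw [sub_smul, d.xiZ_smul_Q hx, algebraMap_smul, sub_self]

/-- A homomorphism from `Z_0(𝔤)` is determined on all `ξ(x)` by its values on a basis. -/
theorem algHom_xiZ_eq {κ R : Type*} [CommRing R] [Algebra K R] (v : Module.Basis κ K (lieAlg K A))
    (η : Module.Dual K (lieAlg K A)) (f : pCentre p K A →ₐ[K] R)
    (h : ∀ k, f (xiZ p (v k)) = algebraMap K R (η (v k) ^ p)) (x : lieAlg K A) :
    f (xiZ p x) = algebraMap K R (η x ^ p) := by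
  have hzero : xiZ p (0 : lieAlg K A) = 0 := by
    have := xiZ_add p (0 : lieAlg K A) 0
    simpa using this
  -- Both sides are additive in `x` and scale by `c^p`.
  induction v.mem_span x using Submodule.span_induction with
  | mem x hx =>
    obtain ⟨k, rfl⟩ := hx
    exact h k
  | zero => rw [hzero, map_zero, map_zero, zero_pow (Fact.out : p.Prime).ne_zero, map_zero]
  | add a b _ _ ha hb =>
    rw [xiZ_add, map_add, ha, hb, map_add, ← map_add,
      commute_add_pow (K := K) p (Commute.all (η a) (η b))]
  | smul c a _ ha =>
    rw [xiZ_smul, map_smul, ha, map_smul, smul_eq_mul, mul_pow, map_mul, Algebra.smul_def]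

namespace AdaptedBasis

variable {d} (B : d.AdaptedBasis)

theorem v_inr_mem (i : Fin B.s) : B.v (Sum.inr i) ∈ d.m := by
  rw [B.v_inr]
  exact (B.x i).2

/-- Modulo `mIdeal` the `ξ` of basis vectors of `𝔪` become scalars; by p-semilinearity the `ξ(y_j)`
generate the quotient. -/
theorem exists_sub_theta_mem (z : pCentre p K A) :
    ∃ f : MvPolynomial (Fin B.r) K, z - B.theta f ∈ d.mIdeal := by
  let π := Ideal.Quotient.mkₐ K d.mIdeal
  let S : Subalgebra K (pCentre p K A) := (π.comp B.theta).range.comap π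
  have hS : ∀ z, z ∈ S → ∃ f : MvPolynomial (Fin B.r) K, z - B.theta f ∈ d.mIdeal := by
    rintro z ⟨f, hf⟩
    exact ⟨f, Ideal.Quotient.eq.1 (show π z = π (B.theta f) from hf.symm)⟩
  have hxi : ∀ x, xiZ p x ∈ S := by
    intro x
    have hzero : xiZ p (0 : lieAlg K A) = 0 := by
      have := xiZ_add p (0 : lieAlg K A) 0
      simpa using this
    induction B.v.mem_span x using Submodule.span_induction with
    | mem x hx =>
      obtain ⟨k | k, rfl⟩ := hx
      · refine ⟨MvPolynomial.X k, ?_⟩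
        change π (B.theta (MvPolynomial.X k)) = π _
        rw [theta, MvPolynomial.aeval_X]
        rfl
      · refine ⟨MvPolynomial.C (d.chi (B.v (Sum.inr k)) ^ p), ?_⟩
        change π (B.theta (algebraMap K _ _)) = π _
        rw [AlgHom.commutes]
        have h : xiZ p (B.v (Sum.inr k)) -
            algebraMap K (pCentre p K A) (d.chi (B.v (Sum.inr k)) ^ p) ∈ d.mIdeal :=
          Ideal.subset_span ⟨_, B.v_inr_mem k, rfl⟩
        exact (Ideal.Quotient.eq.2 h).symm
    | zero => rw [hzero]; exact zero_mem _
    | add a b _ _ ha hb => rw [xiZ_add]; exact add_mem ha hb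
    | smul c a _ ha => rw [xiZ_smul]; exact S.smul_mem ha _
  apply hS
  obtain ⟨u, hu⟩ := z
  induction hu using Algebra.adjoin_induction with
  | mem u hu =>
    obtain ⟨x, rfl⟩ := hu
    exact hxi x
  | algebraMap r => exact S.algebraMap_mem r
  | add a b ha hb iha ihb => exact add_mem iha ihb
  | mul a b ha hb iha ihb => exact mul_mem iha ihb

theorem exists_sub_theta_mem_I (z : pCentre p K A) :
    ∃ f : MvPolynomial (Fin B.r) K, z - B.theta f ∈ d.I := by
  obtain ⟨f, hf⟩ := B.exists_sub_theta_mem z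
  exact ⟨f, d.mIdeal_le_I hf⟩

variable [FiniteDimensional K (lieAlg K A)]

section

variable [Infinite K]

/-- Acting on `1 ⊗ 1`, the restricted monomial with all exponents zero, already recovers the
polynomial. -/
theorem eq_zero_of_theta_mem_annihilator {f : MvPolynomial (Fin B.r) K}
    (hf : B.theta f ∈ Module.annihilator (pCentre p K A) d.Q) : f = 0 := by
  have hp := (Fact.out : p.Prime).pos
  have h : B.expansion (Pi.single (fun _ => ⟨0, hp⟩) f) = B.expansion 0 := by
    rw [expansion_single, map_zero]
    exact Module.mem_annihilator.1 hf _
  have h2 := congrFun (B.expansion_injective h) (fun _ => ⟨0, hp⟩)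
  rwa [Pi.single_eq_same] at h2

theorem eq_zero_of_theta_mem_mIdeal {f : MvPolynomial (Fin B.r) K}
    (hf : B.theta f ∈ d.mIdeal) : f = 0 :=
  B.eq_zero_of_theta_mem_annihilator (d.mIdeal_le_annihilator hf)

theorem annihilator_le_mIdeal (B : d.AdaptedBasis) :
    Module.annihilator (pCentre p K A) d.Q ≤ d.mIdeal := by
  intro z hz
  obtain ⟨f, hf⟩ := B.exists_sub_theta_mem z
  have h : B.theta f ∈ Module.annihilator (pCentre p K A) d.Q := by
    rw [← sub_sub_cancel z (B.theta f)]
    exact sub_mem hz (d.mIdeal_le_annihilator hf)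
  rwa [B.eq_zero_of_theta_mem_annihilator h, map_zero, sub_zero] at hf

/-- The isomorphism of `Z_0(𝔤)` modulo `mIdeal` with a polynomial ring. -/
noncomputable def quotientEquiv :
    MvPolynomial (Fin B.r) K ≃ₐ[K] pCentre p K A ⧸ d.mIdeal :=
  AlgEquiv.ofBijective ((Ideal.Quotient.mkₐ K d.mIdeal).comp B.theta) (by
    constructor
    · rw [injective_iff_map_eq_zero]
      intro f hf
      exact B.eq_zero_of_theta_mem_mIdeal (Ideal.Quotient.eq_zero_iff_mem.1 hf)
    · intro z
      obtain ⟨z, rfl⟩ := Ideal.Quotient.mk_surjective z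
      obtain ⟨f, hf⟩ := B.exists_sub_theta_mem z
      exact ⟨f, (Ideal.Quotient.eq.2 hf).symm⟩)

/-- Evaluation of elements of `Z_0(𝔤)` at the point of `χ + 𝔪^⊥` with coordinates `t`. -/
noncomputable def evalHom (t : Fin B.r → K) : pCentre p K A →ₐ[K] K :=
  (MvPolynomial.aeval t).comp
    ((B.quotientEquiv.symm : _ →ₐ[K] MvPolynomial (Fin B.r) K).comp
      (Ideal.Quotient.mkₐ K d.mIdeal))

theorem evalHom_theta (t : Fin B.r → K) (f : MvPolynomial (Fin B.r) K) :
    B.evalHom t (B.theta f) = MvPolynomial.aeval t f := by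
  change MvPolynomial.aeval t (B.quotientEquiv.symm (B.quotientEquiv f)) = _
  rw [AlgEquiv.symm_apply_apply]

theorem evalHom_eq_zero (t : Fin B.r → K) {z : pCentre p K A} (hz : z ∈ d.mIdeal) :
    B.evalHom t z = 0 := by
  change MvPolynomial.aeval t (B.quotientEquiv.symm (Ideal.Quotient.mk _ z)) = 0
  rw [Ideal.Quotient.eq_zero_iff_mem.2 hz, map_zero, map_zero]

end

/-- Modulo `mIdeal` an element of `I(𝔪)` is a polynomial in the `ξ(y_j)`. Each point `t` of affine
space comes from some `η ∈ χ + 𝔪^⊥`, so this polynomial vanishes everywhere and is zero. -/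
theorem I_le_mIdeal [IsAlgClosed K] (B : d.AdaptedBasis) : d.I ≤ d.mIdeal := by
  intro z hz
  obtain ⟨f, hf⟩ := B.exists_sub_theta_mem z
  suffices h : f = 0 by rwa [h, map_zero, sub_zero] at hf
  refine MvPolynomial.funext fun t => ?_
  -- Since `ξ(y_j)` takes the value `η(y_j)^p` at `η`, the coordinates of `η` must be `p`-th roots
  -- of those of `t`.
  choose s hs using fun j => IsAlgClosed.exists_pow_nat_eq (t j) (Fact.out : p.Prime).pos
  let η : Module.Dual K (lieAlg K A) :=
    B.v.constr K (Sum.elim s fun i => d.chi (B.v (Sum.inr i)))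
  have hηl : ∀ j, η (B.v (Sum.inl j)) = s j := fun j => by simp [η]
  have hηr : ∀ i, η (B.v (Sum.inr i)) = d.chi (B.v (Sum.inr i)) := fun i => by
    simp [η]
  have hηm : η - d.chi ∈ d.mPerp := by
    refine (Submodule.mem_dualAnnihilator _).2 fun x hx => ?_
    have h : (η - d.chi) ∘ₗ d.m.toSubmodule.subtype = 0 := by
      refine B.x.ext fun i => ?_
      change (η - d.chi) (B.x i).1 = 0
      rw [← B.v_inr, LinearMap.sub_apply, hηr, sub_self]
    exact LinearMap.congr_fun h ⟨x, hx⟩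
  have hxi := algHom_xiZ_eq B.v η (B.evalHom t) (by
    rintro (j | i)
    · have h : xiZ p (B.v (Sum.inl j)) = B.theta (MvPolynomial.X j) := by
        rw [theta, MvPolynomial.aeval_X]; rfl
      rw [h, evalHom_theta, MvPolynomial.aeval_X, hηl, hs]
      rfl
    · have h : xiZ p (B.v (Sum.inr i)) -
          algebraMap K (pCentre p K A) (d.chi (B.v (Sum.inr i)) ^ p) ∈ d.mIdeal :=
        Ideal.subset_span ⟨_, B.v_inr_mem i, rfl⟩
      have h2 := B.evalHom_eq_zero t h
      rw [map_sub, AlgHom.commutes, sub_eq_zero] at h2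
      rw [h2, hηr])
  have hle : pointIdeal p η ≤ RingHom.ker (B.evalHom t) := by
    refine Ideal.span_le.2 ?_
    rintro _ ⟨x, rfl⟩
    simp only [SetLike.mem_coe, RingHom.mem_ker]
    rw [map_sub, hxi, AlgHom.commutes, sub_self]
  have hz' : z ∈ pointIdeal p η := by
    simp only [I, vanishingIdeal, Ideal.mem_iInf] at hz
    exact hz η ⟨η - d.chi, hηm, by abel⟩
  have h1 : B.evalHom t z = 0 := hle hz'
  have h2 := B.evalHom_eq_zero t hf
  rw [map_sub, h1, evalHom_theta, zero_sub, neg_eq_zero] at h2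
  rw [map_zero, ← h2, MvPolynomial.aeval_eq_eval]

theorem finrank_mPerp : Module.finrank K d.mPerp = B.r := by
  have h := Subspace.finrank_add_finrank_dualAnnihilator_eq d.m.toSubmodule
  have h1 : Module.finrank K d.m.toSubmodule = B.s := by
    simpa using! Module.finrank_eq_card_basis B.x
  have h2 : Module.finrank K (lieAlg K A) = B.r + B.s := by
    simpa using Module.finrank_eq_card_basis B.v
  change Module.finrank K d.m.toSubmodule.dualAnnihilator = _
  omega

theorem I_eq_annihilator [IsAlgClosed K] (B : d.AdaptedBasis) :
    d.I = Module.annihilator (pCentre p K A) d.Q :=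
  le_antisymm (B.I_le_mIdeal.trans d.mIdeal_le_annihilator)
    (B.annihilator_le_mIdeal.trans d.mIdeal_le_I)

/-- Needed to read the rank off a basis: over the zero ring the rank is not the cardinality of a
basis. -/
theorem nontrivial_quotient [IsAlgClosed K] (B : d.AdaptedBasis) :
    Nontrivial (pCentre p K A ⧸ d.I) := by
  rw [Ideal.Quotient.nontrivial_iff, Ne, Ideal.eq_top_iff_one]
  intro h
  refine one_ne_zero (α := MvPolynomial (Fin B.r) K) (B.eq_zero_of_theta_mem_mIdeal ?_)
  rw [map_one]
  exact B.I_le_mIdeal h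

/-- The restricted monomials in the `y_j` give a basis of `Q_χ` over `Z_0(𝔤) ⧸ I(𝔪)`. -/
theorem nonempty_basis_Q [IsAlgClosed K]
    (h : Module.IsTorsionBySet (pCentre p K A) d.Q d.I) :
    letI : Module (pCentre p K A ⧸ d.I) d.Q := h.module
    Nonempty (Module.Basis (Fin B.r → Fin p) (pCentre p K A ⧸ d.I) d.Q) := by
  refine nonempty_basis_quotient h (fun a => B.restrictedMonomial a • d.genQ) ?_ ?_
  · intro g hg
    choose f hf using fun a => B.exists_sub_theta_mem_I (g a)
    -- As `I(𝔪)` acts by zero, coefficients may be replaced by polynomials in the `ξ(y_j)`.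
    have h1 : ∀ a, g a • B.restrictedMonomial a • d.genQ =
        B.theta (f a) • B.restrictedMonomial a • d.genQ := fun a => by
      rw [← sub_eq_zero, ← sub_smul]
      exact h (a := ⟨_, hf a⟩)
    have h0 : B.expansion f = B.expansion 0 := by
      rw [map_zero, expansion_apply, ← hg]
      exact Finset.sum_congr rfl fun a _ => (h1 a).symm
    intro a
    have h2 := hf a
    rwa [B.expansion_injective h0, Pi.zero_apply, map_zero, sub_zero] at h2
  · intro q
    obtain ⟨f, rfl⟩ := B.expansion_surjective q
    exact ⟨fun a => B.theta (f a), rfl⟩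

end AdaptedBasis

end GelfandGraevData

end Annihilator

end ModularW

/-! ### The annihilator of `Q_χ` and its freeness. -/

theorem mainTheorem8 (p : ℕ) [Fact p.Prime] (K : Type*) [Field K] [IsAlgClosed K] [CharP K p]
    (A : Type*) [CommRing A] [HopfAlgebra K A] [Algebra.FiniteType K A] [IsDomain A]
    (d : ModularW.GelfandGraevData p K A) :
    d.I = Module.annihilator (ModularW.pCentre p K A) d.Q ∧
    ∃ h : Module.IsTorsionBySet (ModularW.pCentre p K A) d.Q d.I,
      letI : Module (ModularW.pCentre p K A ⧸ d.I) d.Q := h.module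
      Module.Free (ModularW.pCentre p K A ⧸ d.I) d.Q ∧
      Module.rank (ModularW.pCentre p K A ⧸ d.I) d.Q = p ^ Module.finrank K d.mPerp := by
  have := ModularW.finiteDimensional_lieAlg (K := K) (A := A)
  obtain ⟨B⟩ := d.nonempty_adaptedBasis
  have hI := B.I_eq_annihilator
  have h : Module.IsTorsionBySet (ModularW.pCentre p K A) d.Q d.I := by
    rw [hI]
    exact fun q a => Module.mem_annihilator.1 a.2 q
  refine ⟨hI, h, ?_⟩
  let _ : Module (ModularW.pCentre p K A ⧸ d.I) d.Q := h.module
  obtain ⟨b⟩ := B.nonempty_basis_Q h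
  have := B.nontrivial_quotient
  refine ⟨Module.Free.of_basis b, ?_⟩
  rw [rank_eq_card_basis b, B.finrank_mPerp]
  simp
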